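/- **Setting.** A standard complex Gaussian is a complex random variable whose real and imaginary parts are independent $N(0,\tfrac12)$ variables. For positive integers $n,s$, a Wishart matrix $W\in W(n,s)$ is a random $n\times n$ matrix with the law of $GG^*$, where $G$ is an $n\times s$ random matrix with i.i.d. standard complex Gaussian entries. Let $W_1,W_2\in W(d_1d_2,s)$ be two Wishart matrices on $\mathbb C^{d_1}\otimes\mathbb C^{d_2}$, and define their entanglement swapping, a random $d_2^2\times d_2^2$ matrix, by $$W=\frac1{d_1}\,\mathrm{Tr}_{d_1}\big[(W_1\otimes W_2)\,P_{d_1}\big],\qquad P_{d_1}=\sum_{i,j=1}^{d_1}|i\rangle\langle j|\otimes|i\rangle\langle j| .$$ Here $W_1\otimes W_2$ is regarded as an operator on $(\mathbb C^{d_1}\otimes\mathbb C^{d_1})\otimes(\mathbb C^{d_2}\otimes\mathbb C^{d_2})$ (the two tensor factors of dimension $d_1$ are grouped together), $P_{d_1}$ acts on $\mathbb C^{d_1}\otimes\mathbb C^{d_1}$ (and as the identity on $\mathbb C^{d_2}\otimes\mathbb C^{d_2}$), and $\mathrm{Tr}_{d_1}$ is the partial trace over $\mathbb C^{d_1}\otimes\mathbb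 C^{d_1}$. Put $$Z=d_2s\left(\frac{W}{d_2^2s^2}-\frac{\mathbf 1}{d_2^2}\right).$$ For an integer $p\ge0$ let $NC^0(p)$ be the set of partitions $\pi$ of $[p]=\{1,\dots,p\}$ that have no block of size one and are non-crossing (there are no $a_1<b_1<a_2<b_2$ in $[p]$ with $a_1,a_2$ in one block and $b_1,b_2$ in a different block), and let $\#\pi$ be the number of blocks of $\pi$. **Theorem.** Let $c>0$ be a constant. Suppose that, for all parameters $(d_1,d_2,s)$, either $W_1$ and $W_2$ are independent (Case I), or, for all parameters, $W_1=W_2$ (Case II). Then for every $p\ge 0$ the random variable $\mathrm{Tr}[Z^p]$ is integrable, and when $d_1,d_2\to\infty$ jointly, in any manner, with $s/d_2\to c$, $$\lim_{\substack{d_1,d_2\to\infty\\ s/d_2\to c}}\ \frac1{d_2^2}\,\mathbb E\,\mathrm{Tr}[Z^p]=\sum_{\pi\in NC^0(p)}c^{\,2\#\pi-p}.$$ -/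

import Mathlib

open MeasureTheory ProbabilityTheory Filter Topology
open scoped Kronecker Matrix

/-- The standard complex Gaussian distribution on `ℂ`: real and imaginary parts are independent
centred real Gaussians of variance `1/2`, so that `E|g|² = 1`. -/
noncomputable def stdComplexGaussian : Measure ℂ :=
  ((gaussianReal 0 (1 / 2)).prod (gaussianReal 0 (1 / 2))).map (fun x : ℝ × ℝ => (⟨x.1, x.2⟩ : ℂ))

/-- The law of an `m × n` random matrix whose entries are independent and identically distributed
standard complex Gaussian random variables. -/
noncomputable def gaussianMatrix (m n : Type*) [Fintype m] [Fintype n] : Measure (m → n → ℂ) :=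
  Measure.pi fun _ : m => Measure.pi fun _ : n => stdComplexGaussian

/-- Random matrices are measurable with respect to the product sigma-algebra on the entries. -/
noncomputable instance matrixMeasurableSpace {m n : Type*} : MeasurableSpace (Matrix m n ℂ) :=
  inferInstanceAs (MeasurableSpace (m → n → ℂ))

/-- The Wishart distribution `W(n, s)`, on matrices whose rows and columns are indexed by a type
`m` with `n` elements: the law of `G Gᴴ`, where `G` is an `m × s` matrix with i.i.d. standard
complex Gaussian entries. -/
noncomputable def wishart (m : Type*) [Fintype m] (s : ℕ) : Measure (Matrix m m ℂ) :=
  (gaussianMatrix m (Fin s)).map fun g => Matrix.of g * (Matrix.of g)ᴴ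

/-- The partial trace over the first tensor factor: `∑ E_{ij} ⊗ T_{ij} ↦ ∑ⱼ T_{jj}`. -/
def partialTraceLeft {a b : Type*} [Fintype a] (T : Matrix (a × b) (a × b) ℂ) : Matrix b b ℂ :=
  Matrix.of fun k l => ∑ j, T (j, k) (j, l)

/-- The (unnormalized) Bell projection `∑_{i,j} |i⟩⟨j| ⊗ |i⟩⟨j|` on `ℂ^d ⊗ ℂ^d`. -/
def bellProjection (d : ℕ) : Matrix (Fin d × Fin d) (Fin d × Fin d) ℂ :=
  ∑ i : Fin d, ∑ j : Fin d, Matrix.single i j (1 : ℂ) ⊗ₖ Matrix.single i j (1 : ℂ)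

/-- `W₁ ⊗ W₂`, an operator on `(ℂ^{d₁} ⊗ ℂ^{d₂}) ⊗ (ℂ^{d₁} ⊗ ℂ^{d₂})`, regarded as an operator on
`(ℂ^{d₁} ⊗ ℂ^{d₁}) ⊗ (ℂ^{d₂} ⊗ ℂ^{d₂})` by exchanging the two middle tensor factors. -/
def tensorRegrouped {d₁ d₂ : ℕ} (W₁ W₂ : Matrix (Fin d₁ × Fin d₂) (Fin d₁ × Fin d₂) ℂ) :
    Matrix ((Fin d₁ × Fin d₁) × (Fin d₂ × Fin d₂)) ((Fin d₁ × Fin d₁) × (Fin d₂ × Fin d₂)) ℂ :=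
  Matrix.reindex (Equiv.prodProdProdComm _ _ _ _) (Equiv.prodProdProdComm _ _ _ _) (W₁ ⊗ₖ W₂)

/-- The entanglement swapping `W = (1/d₁) Tr_{d₁}[(W₁ ⊗ W₂) P_{d₁}]`, where `P_{d₁}` acts on the
two parties of dimension `d₁` and both of these parties are traced out. -/
noncomputable def entanglementSwapping {d₁ d₂ : ℕ}
    (W₁ W₂ : Matrix (Fin d₁ × Fin d₂) (Fin d₁ × Fin d₂) ℂ) :
    Matrix (Fin d₂ × Fin d₂) (Fin d₂ × Fin d₂) ℂ :=
  (1 / (d₁ : ℂ)) • partialTraceLeft (tensorRegrouped W₁ W₂ *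
    (bellProjection d₁ ⊗ₖ (1 : Matrix (Fin d₂ × Fin d₂) (Fin d₂ × Fin d₂) ℂ)))

/-- The rescaled matrix `Z = d₂ s (W / (d₂² s²) - 1 / d₂²)`, where `W` is the entanglement
swapping of `W₁` and `W₂`. -/
noncomputable def rescaledSwapping {d₁ d₂ : ℕ} (s : ℕ)
    (W₁ W₂ : Matrix (Fin d₁ × Fin d₂) (Fin d₁ × Fin d₂) ℂ) :
    Matrix (Fin d₂ × Fin d₂) (Fin d₂ × Fin d₂) ℂ :=
  ((d₂ : ℂ) * (s : ℂ)) •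
    ((1 / ((d₂ : ℂ) ^ 2 * (s : ℂ) ^ 2)) • entanglementSwapping W₁ W₂ - (1 / (d₂ : ℂ) ^ 2) • 1)

/-- A partition of `[p]` is non-crossing if there are no `a₁ < b₁ < a₂ < b₂` with `a₁, a₂` in one
block and `b₁, b₂` in another block. -/
def IsNonCrossing {p : ℕ} (π : Finpartition (Finset.univ : Finset (Fin p))) : Prop :=
  ∀ a₁ b₁ a₂ b₂ : Fin p, a₁ < b₁ → b₁ < a₂ → a₂ < b₂ →
    ∀ U ∈ π.parts, ∀ V ∈ π.parts, a₁ ∈ U → a₂ ∈ U → b₁ ∈ V → b₂ ∈ V → U = V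

open Classical in
/-- `NC⁰(p)`: the non-crossing partitions of `[p]` without singletons. -/
noncomputable def nonCrossingNoSingletons (p : ℕ) :
    Finset (Finpartition (Finset.univ : Finset (Fin p))) :=
  Finset.univ.filter fun π => IsNonCrossing π ∧ ∀ V ∈ π.parts, V.card ≠ 1

/-! The trace of a power of `Z` is expanded in Gaussian entries and integrated by Wick's formula.
With p = n + 1, the pairings are permutations σ of `Fin (n + 1) × Bool`, the Boolean naming the
tensor leg. Subtracting the identity in `Z` removes exactly the σ that fix both legs of some factor
(`IsGaussianFamily.wick_centred`).

Summing over indices (`card_compatible_labels`), σ contributes N(σ) d₂^#(γσ⁻¹) s^#σ, where N(σ) =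
`pairingCount` counts the d₁-indices, # counts cycles and γ rotates both legs. Two bounds control
this against the normalisation (d₁d₂s)^(n+1) d₂². First, N(σ) ≤ d₁^(n+1), with a loss of at least
1/d₁ unless σ sends the two legs of each factor to a common factor. Second, #(γσ⁻¹) + #σ ≤ 2(n+1) +
2, since γ has two cycles; a strict inequality costs at least 1/d₂. Each loss vanishes by itself, so
d₁ and d₂ may grow in any relation.

If both bounds are attained, σ preserves the cycles of γ, hence the legs, and therefore acts as one
permutation α on both (`IsLeadingPairing.exists_eq`). Such σ are admissible whether the matrices are
independent or equal, so the two cases share a limit. The remaining α are the fixed-point-free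
permutations on a geodesic from the identity to the long cycle. They correspond to non-crossing
partitions without singletons (`sum_isGeodesic_eq_sum_nonCrossing`), each with weight c^(2#α − p).

The cycle inequalities are linear algebra: #σ is the dimension of the space of σ-invariant
functions, so the genus bound is the dimension formula for a sum of two subspaces. -/

/-! ### Cycle counts as dimensions of spaces of invariant functions. -/

section FixedFunctions

open Equiv

variable {X : Type*}

/-- The rational functions that are constant on the classes of an equivalence relation. -/
def classFunctions (r : Setoid X) : Submodule ℚ (X → ℚ) where
  carrier := {f | ∀ x y, r x y → f x = f y}
  add_mem' hf hg x y h := by simp [hf x y h, hg x y h]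
  zero_mem' x y _ := rfl
  smul_mem' c f hf x y h := by simp [hf x y h]

/-- Functions constant on the classes are the functions on the quotient. -/
def classFunctionEquiv (r : Setoid X) (A : Type*) :
    {f : X → A // ∀ x y, r x y → f x = f y} ≃ (Quotient r → A) where
  toFun f := Quotient.lift f.1 f.2
  invFun g := ⟨fun x => g (Quotient.mk r x), fun _ _ h => congrArg g (Quotient.sound h)⟩
  left_inv _ := rfl
  right_inv g := by
    funext q
    induction q using Quotient.ind
    rfl

theorem finrank_classFunctions [Finite X] (r : Setoid X) :
    Module.finrank ℚ (classFunctions r) = Nat.card (Quotient r) := by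
  classical
  have := Fintype.ofFinite (Quotient r)
  let e : classFunctions r ≃ₗ[ℚ] (Quotient r → ℚ) :=
    { classFunctionEquiv r ℚ with
      map_add' := fun f g => by
        funext q
        induction q using Quotient.ind
        rfl
      map_smul' := fun c f => by
        funext q
        induction q using Quotient.ind
        rfl }
  rw [e.finrank_eq, Module.finrank_fintype_fun_eq_card, Nat.card_eq_fintype_card]

/-- The rational functions invariant under a permutation. -/
def fixedFunctions (σ : Perm X) : Submodule ℚ (X → ℚ) where
  carrier := {f | ∀ x, f (σ x) = f x}
  add_mem' hf hg x := by simp [hf x, hg x]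
  zero_mem' _ := rfl
  smul_mem' c f hf x := by simp [hf x]

theorem mem_fixedFunctions {σ : Perm X} {f : X → ℚ} :
    f ∈ fixedFunctions σ ↔ ∀ x, f (σ x) = f x := Iff.rfl

/-- The number of cycles of a permutation, fixed points included. -/
noncomputable def cycleCount (σ : Perm X) : ℕ := Module.finrank ℚ (fixedFunctions σ)

theorem apply_eq_of_sameCycle {A : Type*} {σ : Perm X} {f : X → A} (hf : ∀ x, f (σ x) = f x)
    {x y : X} (h : σ.SameCycle x y) : f x = f y := by
  obtain ⟨k, rfl⟩ := h
  have hinv : ∀ x, f (σ⁻¹ x) = f x := fun x => by simpa using (hf (σ⁻¹ x)).symm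
  induction k using Int.induction_on generalizing x with
  | zero => simp
  | succ n ih => rw [zpow_add_one, Perm.mul_apply, ← ih, hf]
  | pred n ih => rw [zpow_sub_one, Perm.mul_apply, ← ih, hinv]

theorem forall_apply_eq_iff {A : Type*} {σ : Perm X} {f : X → A} :
    (∀ x, f (σ x) = f x) ↔ ∀ x y, Perm.SameCycle.setoid σ x y → f x = f y :=
  ⟨fun hf _ _ h => apply_eq_of_sameCycle hf h,
    fun hf x => hf _ _ (Perm.sameCycle_apply_left.2 (Perm.SameCycle.refl σ x))⟩

theorem fixedFunctions_eq_classFunctions (σ : Perm X) :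
    fixedFunctions σ = classFunctions (Perm.SameCycle.setoid σ) :=
  Submodule.ext fun _ => forall_apply_eq_iff

theorem cycleCount_eq_card [Finite X] (σ : Perm X) :
    cycleCount σ = Nat.card (Quotient (Perm.SameCycle.setoid σ)) := by
  rw [cycleCount, fixedFunctions_eq_classFunctions, finrank_classFunctions]

/-- The number of colourings invariant under a permutation. -/
theorem card_invariant_colourings [Finite X] (σ : Perm X) (A : Type*) :
    Nat.card {f : X → A // ∀ x, f (σ x) = f x} = Nat.card A ^ cycleCount σ := by
  rw [Nat.card_congr ((Equiv.subtypeEquivRight fun _ => forall_apply_eq_iff).trans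
    (classFunctionEquiv (Perm.SameCycle.setoid σ) A)), Nat.card_fun, cycleCount_eq_card]

theorem sameCycle_of_fixedFunctions {σ : Perm X} {x y : X}
    (h : ∀ f ∈ fixedFunctions σ, f x = f y) : σ.SameCycle x y := by
  classical
  have := h (fun z => if σ.SameCycle x z then 1 else 0) fun z => by
    simp only [Perm.sameCycle_apply_right]
  simpa [Perm.SameCycle.refl] using this

variable [Fintype X]

/-- A function invariant under both permutations is invariant under the product, and the sum of the
two invariant subspaces has dimension at most |X|. Equality forces the intersection to be all of
`fixedFunctions (τ * σ)`. -/
theorem cycleCount_add_le_and (σ τ : Perm X) :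
    cycleCount σ + cycleCount τ ≤ Fintype.card X + cycleCount (τ * σ) ∧
    (cycleCount σ + cycleCount τ = Fintype.card X + cycleCount (τ * σ) →
      fixedFunctions (τ * σ) ≤ fixedFunctions σ) := by
  have h1 := Submodule.finrank_sup_add_finrank_inf_eq (fixedFunctions σ) (fixedFunctions τ)
  have h2 : fixedFunctions σ ⊓ fixedFunctions τ ≤ fixedFunctions (τ * σ) := by
    rintro f ⟨hσ, hτ⟩ x
    rw [Perm.mul_apply, hτ, hσ]
  have h3 := Submodule.finrank_mono h2
  have h4 := Submodule.finrank_le (fixedFunctions σ ⊔ fixedFunctions τ)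
  rw [Module.finrank_fintype_fun_eq_card] at h4
  unfold cycleCount
  refine ⟨by lia, fun h => ?_⟩
  rw [← Submodule.eq_of_le_of_finrank_le h2 (by lia)]
  exact inf_le_left

/-- The single linear condition f a = f b cuts `fixedFunctions (σ * swap a b)` down into
`fixedFunctions σ`, and one condition lowers the dimension by at most one. -/
theorem cycleCount_mul_swap_le [DecidableEq X] (σ : Perm X) (a b : X) :
    cycleCount (σ * swap a b) ≤ cycleCount σ + 1 := by
  let φ : (X → ℚ) →ₗ[ℚ] ℚ :=
    LinearMap.proj (R := ℚ) (φ := fun _ => ℚ) a - LinearMap.proj (R := ℚ) (φ := fun _ => ℚ) b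
  have h1 := Submodule.finrank_sup_add_finrank_inf_eq (fixedFunctions (σ * swap a b))
    (LinearMap.ker φ)
  have h2 : fixedFunctions (σ * swap a b) ⊓
      LinearMap.ker φ ≤
        fixedFunctions σ := by
    rintro f ⟨hf, hab⟩ x
    have hab : f a = f b := by simpa [φ, sub_eq_zero] using hab
    have h := hf (swap a b x)
    rw [Perm.mul_apply, swap_apply_self] at h
    rw [h, swap_apply_def]
    split_ifs with h1 h2
    · rw [h1, hab]
    · rw [h2, hab]
    · rfl
  have h3 := Submodule.finrank_mono h2
  have h4 := Submodule.finrank_le (fixedFunctions (σ * swap a b) ⊔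
    LinearMap.ker φ)
  have h5 := LinearMap.finrank_range_add_finrank_ker
    φ
  have h6 := Submodule.finrank_le
    (LinearMap.range φ)
  rw [Module.finrank_self] at h6
  rw [Module.finrank_fintype_fun_eq_card] at h4 h5
  unfold cycleCount
  lia

/-- Splitting a cycle by a transposition increases the number of cycles. -/
theorem cycleCount_lt_mul_swap [DecidableEq X] {σ : Perm X} {a b : X} (hab : a ≠ b)
    (h : σ.SameCycle a b) : cycleCount σ < cycleCount (σ * swap a b) := by
  apply Submodule.finrank_lt_finrank_of_lt
  refine lt_of_le_of_ne (fun f hf x => ?_) fun heq => ?_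
  · rw [Perm.mul_apply, hf, swap_apply_def]
    split_ifs with h1 h2
    · rw [h1, apply_eq_of_sameCycle hf h]
    · rw [h2, apply_eq_of_sameCycle hf h]
    · rfl
  · obtain ⟨n, hn⟩ := h.exists_nat_pow_eq
    have hex : ∃ n, (σ ^ n) a = b := ⟨n, hn⟩
    set k := Nat.find hex with hk
    have hkb : (σ ^ k) a = b := Nat.find_spec hex
    have hmin : ∀ j < k, (σ ^ j) a ≠ b := fun j hj => Nat.find_min hex hj
    have hk0 : 0 < k := Nat.pos_of_ne_zero fun h0 => hab (by simpa [h0] using hkb)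
    -- A return to `a` before time `k` would make the orbit reach `b` earlier than `k`.
    have hret : ∀ j, 0 < j → j < k → (σ ^ j) a ≠ a := fun j hj hjk hja => by
      refine hmin (k - j) (by lia) ?_
      rw [← hkb, show σ ^ k = σ ^ (k - j) * σ ^ j by rw [← pow_add]; congr 1; lia,
        Perm.mul_apply, hja]
    -- the arc from `σ a` to `b` is invariant
    let S : Finset X := (Finset.Icc 1 k).image fun j => (σ ^ j) a
    have hS : ∀ x ∈ S, (σ * swap a b) x ∈ S := by
      intro x hx
      obtain ⟨j, hj, rfl⟩ := Finset.mem_image.1 hx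
      rw [Finset.mem_Icc] at hj
      rcases hj.2.lt_or_eq with hlt | rfl
      · rw [Perm.mul_apply, swap_apply_of_ne_of_ne (hret j hj.1 hlt) (hmin j hlt)]
        refine Finset.mem_image.2 ⟨j + 1, Finset.mem_Icc.2 ⟨by lia, hlt⟩, ?_⟩
        simp only [pow_succ', Perm.mul_apply]
      · rw [Perm.mul_apply, hkb, swap_apply_right]
        exact Finset.mem_image.2 ⟨1, Finset.mem_Icc.2 ⟨le_rfl, hj.1⟩, by simp⟩
    have hS' : ∀ x, (σ * swap a b) x ∈ S ↔ x ∈ S := fun x => by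
      refine ⟨fun hx => ?_, hS x⟩
      have himg : S.image (σ * swap a b) = S :=
        Finset.eq_of_subset_of_card_le
          (fun y hy => by obtain ⟨z, hz, rfl⟩ := Finset.mem_image.1 hy; exact hS z hz)
          (by rw [Finset.card_image_of_injective _ (Equiv.injective _)])
      rw [← himg, Finset.mem_image] at hx
      obtain ⟨z, hz, hzx⟩ := hx
      rwa [← (Equiv.injective _) hzx]
    have hmem : (fun x => if x ∈ S then (1 : ℚ) else 0) ∈ fixedFunctions (σ * swap a b) := by
      intro x
      simp only [hS']
    rw [← heq] at hmem
    have hne := apply_eq_of_sameCycle (mem_fixedFunctions.1 hmem) h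
    have hbS : b ∈ S := Finset.mem_image.2 ⟨k, Finset.mem_Icc.2 ⟨hk0, le_rfl⟩, hkb⟩
    have haS : a ∉ S := by
      intro ha
      obtain ⟨j, hj, hja⟩ := Finset.mem_image.1 ha
      rw [Finset.mem_Icc] at hj
      rcases hj.2.lt_or_eq with hlt | rfl
      · exact hret j hj.1 hlt hja
      · exact hab (hja.symm.trans hkb)
    simp [hbS, haS] at hne

theorem cycleCount_mul_inv_add_le (σ γ : Perm X) :
    cycleCount σ + cycleCount (γ * σ⁻¹) ≤ Fintype.card X + cycleCount γ := by
  simpa using (cycleCount_add_le_and σ (γ * σ⁻¹)).1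

theorem fixedFunctions_le_of_geodesic {σ γ : Perm X}
    (h : Fintype.card X + cycleCount γ ≤ cycleCount σ + cycleCount (γ * σ⁻¹)) :
    fixedFunctions γ ≤ fixedFunctions σ := by
  have h1 := (cycleCount_add_le_and σ (γ * σ⁻¹)).2
  simp only [inv_mul_cancel_right] at h1
  exact h1 (le_antisymm (cycleCount_mul_inv_add_le σ γ) h)

/-- If `σ` is geodesic for `γ` and `a, b` lie in one cycle of `σ`, then the functions invariant
under `γ * swap a b` are invariant under `σ * swap a b`. -/
theorem fixedFunctions_mul_swap_le [DecidableEq X] {σ γ : Perm X}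
    (h : cycleCount σ + cycleCount (γ * σ⁻¹) = Fintype.card X + cycleCount γ) {a b : X}
    (hab : a ≠ b) (hs : σ.SameCycle a b) :
    fixedFunctions (γ * swap a b) ≤ fixedFunctions (σ * swap a b) := by
  apply fixedFunctions_le_of_geodesic
  have h1 := cycleCount_lt_mul_swap hab hs
  have h2 := cycleCount_mul_swap_le γ a b
  have h3 : γ * swap a b * (σ * swap a b)⁻¹ = γ * σ⁻¹ := by
    -- The transposition cancels, so γσ⁻¹ is unchanged, while #σ rises by at least one and #γ by at
    -- most one: the pair stays geodesic.
    rw [mul_inv_rev, swap_inv, mul_assoc, ← mul_assoc (swap a b), swap_mul_self, one_mul]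
  rw [h3]
  lia

end FixedFunctions

/-! ### Geodesic permutations and non-crossing partitions. -/

section NonCrossing

open Equiv

variable {n : ℕ}

theorem ite_one_zero_inj {P Q : Prop} [Decidable P] [Decidable Q] :
    (if P then (1 : ℚ) else 0) = (if Q then 1 else 0) ↔ (P ↔ Q) := by
  by_cases hP : P <;> by_cases hQ : Q <;> simp [hP, hQ]

theorem iff_of_sameCycle {X : Type*} {σ : Perm X} {q : X → Prop} (hq : ∀ x, q (σ x) ↔ q x)
    {x y : X} (h : σ.SameCycle x y) : q x ↔ q y :=
  Iff.of_eq (apply_eq_of_sameCycle (f := q) (fun x => propext (hq x)) h)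

/-- Permutations on a geodesic from the identity to the long cycle. -/
def IsGeodesic (σ : Perm (Fin (n + 1))) : Prop :=
  cycleCount σ + cycleCount (finRotate (n + 1) * σ⁻¹) = n + 2

theorem cycleCount_finRotate : cycleCount (finRotate (n + 1)) = 1 := by
  have h : fixedFunctions (finRotate (n + 1)) = Submodule.span ℚ {fun _ => 1} := by
    ext f
    rw [Submodule.mem_span_singleton]
    constructor
    · intro hf
      refine ⟨f 0, funext fun x => ?_⟩
      induction x using Fin.induction with
      | zero => simp
      | succ i ih =>
        rw [← Fin.coeSucc_eq_succ, ← finRotate_apply, hf, ← ih]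
        simp
    · rintro ⟨c, rfl⟩ x
      rfl
  rw [cycleCount, h, finrank_span_singleton]
  exact fun h0 => one_ne_zero (congrFun h0 0)

theorem cycleCount_add_le_of_long_cycle (σ : Perm (Fin (n + 1))) :
    cycleCount σ + cycleCount (finRotate (n + 1) * σ⁻¹) ≤ n + 2 := by
  simpa [cycleCount_finRotate] using cycleCount_mul_inv_add_le σ (finRotate (n + 1))

/-- The transposition splits the long cycle into two arcs, of which (a, b] is one. -/
theorem finRotate_mul_swap_mem_Ioc {a b : Fin (n + 1)} (hab : a < b) (x : Fin (n + 1)) :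
    (finRotate (n + 1) * swap a b) x ∈ Finset.Ioc a b ↔ x ∈ Finset.Ioc a b := by
  rw [Perm.mul_apply, swap_apply_def]
  simp only [Finset.mem_Ioc, Fin.lt_def, Fin.le_def, coe_finRotate]
  rw [Fin.lt_def] at hab
  have hb := b.is_lt
  have hx := x.is_lt
  split_ifs with h1 h2 h3 h4 h5 <;> simp_all [Fin.ext_iff] <;> lia

theorem IsGeodesic.mul_swap_mem_Ioc {σ : Perm (Fin (n + 1))} (h : IsGeodesic σ)
    {a b : Fin (n + 1)} (hab : a < b) (hs : σ.SameCycle a b) (x : Fin (n + 1)) :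
    σ (swap a b x) ∈ Finset.Ioc a b ↔ x ∈ Finset.Ioc a b := by
  have hle := fixedFunctions_mul_swap_le (σ := σ) (γ := finRotate (n + 1))
    (by rw [h, cycleCount_finRotate, Fintype.card_fin]) hab.ne hs
  have hmem : (fun x => if x ∈ Finset.Ioc a b then (1 : ℚ) else 0) ∈
      fixedFunctions (finRotate (n + 1) * swap a b) := fun x => by
    simp only [finRotate_mul_swap_mem_Ioc hab]
  exact ite_one_zero_inj.1 (mem_fixedFunctions.1 (hle hmem) x)

/-- The cycles of a geodesic permutation do not cross. -/
theorem IsGeodesic.sameCycle_of_crossing {σ : Perm (Fin (n + 1))} (h : IsGeodesic σ)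
    {a₁ b₁ a₂ b₂ : Fin (n + 1)} (h1 : a₁ < b₁) (h2 : b₁ < a₂) (h3 : a₂ < b₂)
    (ha : σ.SameCycle a₁ a₂) (hb : σ.SameCycle b₁ b₂) : σ.SameCycle a₁ b₁ := by
  by_contra hne
  -- The transposition of a₁ and a₂ does not touch the cycle of b₁, so on that cycle σ itself
  -- preserves (a₁, a₂]; but this interval contains b₁ and not b₂.
  have hmem : ∀ x, (σ.SameCycle b₁ (σ x) ∧ σ x ∈ Finset.Ioc a₁ a₂) ↔
      (σ.SameCycle b₁ x ∧ x ∈ Finset.Ioc a₁ a₂) := by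
    intro x
    rw [Perm.sameCycle_apply_right]
    refine and_congr_right fun hx => ?_
    have h4 := h.mul_swap_mem_Ioc (h1.trans h2) ha x
    rwa [swap_apply_of_ne_of_ne] at h4
    · rintro rfl
      exact hne hx.symm
    · rintro rfl
      exact hne (ha.trans hx.symm)
  have h5 := iff_of_sameCycle (q := fun x => σ.SameCycle b₁ x ∧ x ∈ Finset.Ioc a₁ a₂) hmem hb
  simp [h1, h2.le, h3.not_ge, Perm.SameCycle.refl] at h5

/-- Multiplying by the transposition of u and v = σ u cuts v out of its cycle. The rest of the cycle
then lies entirely inside or entirely outside the invariant arc between them. -/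
theorem IsGeodesic.mem_Ioc_iff {σ : Perm (Fin (n + 1))} (h : IsGeodesic σ)
    {u v a b : Fin (n + 1)} (huv : σ u = v) (hne : u ≠ v) (hlt : a < b)
    (hab : swap a b = swap u v) (hs : σ.SameCycle a b)
    {c : Fin (n + 1)} (hc : σ.SameCycle u c) (hcv : c ≠ v) :
    c ∈ Finset.Ioc a b ↔ u ∈ Finset.Ioc a b := by
  have hI := h.mul_swap_mem_Ioc hlt hs
  rw [hab] at hI
  -- Giving v the membership value of u makes the predicate invariant under σ itself.
  have hf : ∀ x, (if σ x = v then u ∈ Finset.Ioc a b else σ x ∈ Finset.Ioc a b) ↔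
      (if x = v then u ∈ Finset.Ioc a b else x ∈ Finset.Ioc a b) := by
    intro x
    by_cases hxu : x = u
    · simp [hxu, huv, hne]
    have hσx : σ x ≠ v := fun h0 => hxu (σ.injective (h0.trans huv.symm))
    by_cases hxv : x = v
    · subst hxv
      have := hI u
      rw [swap_apply_left] at this
      simp only [hσx, if_false, if_true, this]
    · have := hI x
      rw [swap_apply_of_ne_of_ne hxu hxv] at this
      simp only [hσx, hxv, if_false, this]
  have := iff_of_sameCycle
    (q := fun x => if x = v then u ∈ Finset.Ioc a b else x ∈ Finset.Ioc a b) hf hc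
  simpa [hne, hcv] using this.symm

/-- Together with `IsGeodesic.mem_Icc`: σ sends each point to the next larger one of its cycle, and
the largest to the smallest. The cycles therefore determine σ. -/
theorem IsGeodesic.not_between {σ : Perm (Fin (n + 1))} (h : IsGeodesic σ) {u c : Fin (n + 1)}
    (huv : u < σ u) (hc : σ.SameCycle u c) : c ≤ u ∨ σ u ≤ c := by
  rcases eq_or_ne c (σ u) with rfl | hcv
  · exact Or.inr le_rfl
  have := h.mem_Ioc_iff rfl huv.ne huv rfl (Perm.sameCycle_apply_right.2 (Perm.SameCycle.refl σ u))
    hc hcv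
  simp only [Finset.mem_Ioc, lt_irrefl, false_and, iff_false, not_and, not_le] at this
  exact or_iff_not_imp_left.2 fun hcu => (this (not_le.1 hcu)).le

theorem IsGeodesic.mem_Icc {σ : Perm (Fin (n + 1))} (h : IsGeodesic σ) {u c : Fin (n + 1)}
    (huv : σ u < u) (hc : σ.SameCycle u c) : σ u ≤ c ∧ c ≤ u := by
  rcases eq_or_ne c (σ u) with rfl | hcv
  · exact ⟨le_rfl, huv.le⟩
  have := h.mem_Ioc_iff rfl huv.ne' huv (swap_comm _ _)
    (Perm.sameCycle_apply_left.2 (Perm.SameCycle.refl σ u)) hc hcv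
  simp only [Finset.mem_Ioc, huv, le_refl, and_self, iff_true] at this
  exact ⟨this.1.le, this.2⟩

/-- A geodesic permutation is determined by its cycles. -/
theorem IsGeodesic.eq_of_sameCycle {σ τ : Perm (Fin (n + 1))} (hσ : IsGeodesic σ)
    (hτ : IsGeodesic τ) (h : ∀ x y, σ.SameCycle x y ↔ τ.SameCycle x y) : σ = τ := by
  ext1 u
  have h1 : σ.SameCycle u (τ u) :=
    (h _ _).2 (Perm.sameCycle_apply_right.2 (Perm.SameCycle.refl τ u))
  have h2 : τ.SameCycle u (σ u) :=
    (h _ _).1 (Perm.sameCycle_apply_right.2 (Perm.SameCycle.refl σ u))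
  have fix : ∀ {ρ : Perm (Fin (n + 1))} {x y}, ρ x = x → ρ.SameCycle x y → x = y :=
    fun hx hxy => (hxy.eq_of_left hx)
  rcases lt_trichotomy u (σ u) with hs | hs | hs
  · rcases lt_trichotomy u (τ u) with ht | ht | ht
    · rcases hσ.not_between hs h1 with h3 | h3 <;> rcases hτ.not_between ht h2 with h4 | h4 <;> order
    · exact absurd (fix ht.symm h2) hs.ne
    · have := hτ.mem_Icc ht h2
      order
  · rw [← hs]
    exact fix hs.symm h1
  · rcases lt_trichotomy u (τ u) with ht | ht | ht
    · have := hσ.mem_Icc hs h1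
      order
    · exact absurd (fix ht.symm h2) hs.ne'
    · have := hσ.mem_Icc hs h1
      have := hτ.mem_Icc ht h2
      order

theorem mem_fixedFunctions_mul_swap {σ : Perm (Fin (n + 1))} {u v : Fin (n + 1)} (hv : σ v = v)
    {f : Fin (n + 1) → ℚ} :
    f ∈ fixedFunctions (σ * swap u v) ↔ f ∈ fixedFunctions σ ∧ f u = f v := by
  simp only [mem_fixedFunctions, Perm.mul_apply]
  constructor
  · intro hf
    have huv : f u = f v := by rw [← hf u, swap_apply_left, hv]
    refine ⟨fun x => ?_, huv⟩
    have h := hf (swap u v x)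
    rw [swap_apply_self] at h
    rw [h, swap_apply_def]
    split_ifs with h1 h2
    · rw [h1, huv]
    · rw [h2, huv]
    · rfl
  · rintro ⟨hf, huv⟩ x
    rw [hf, swap_apply_def]
    split_ifs with h1 h2
    · rw [h1, huv]
    · rw [h2, huv]
    · rfl

theorem sum_finRotate_Ico (u v : Fin (n + 1)) (f : Fin (n + 1) → ℚ) :
    ∑ x ∈ Finset.Ico u v, f (finRotate (n + 1) x) = ∑ x ∈ Finset.Ioc u v, f x := by
  refine Finset.sum_bij (fun x _ => finRotate (n + 1) x) (fun x hx => ?_)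
    (fun _ _ _ _ h => (finRotate (n + 1)).injective h) (fun y hy => ?_) fun _ _ => rfl
  · have hx' : x ≠ Fin.last n := fun h => by
      have := Finset.mem_Ico.1 hx
      have := Fin.le_last v
      order
    have := v.is_lt
    simp only [Finset.mem_Ico, Finset.mem_Ioc, Fin.lt_def, Fin.le_def,
      coe_finRotate_of_ne_last hx'] at hx ⊢
    lia
  · refine ⟨(finRotate (n + 1)).symm y, ?_, by simp⟩
    have hy' : y ≠ 0 := fun h => by
      have := Finset.mem_Ioc.1 hy
      have := Fin.zero_le u
      order
    simp only [Finset.mem_Ico, Finset.mem_Ioc, Fin.lt_def, Fin.le_def,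
      coe_finRotate_symm_of_ne_zero hy'] at hy ⊢
    have : (y : ℕ) ≠ 0 := fun h => hy' (Fin.ext h)
    lia

/-- Joining a fixed point `v` to the cycle of `u < v` keeps a permutation geodesic when all points
of `(u, v]` are fixed. -/
theorem IsGeodesic.mul_swap {σ : Perm (Fin (n + 1))} (h : IsGeodesic σ) {u v : Fin (n + 1)}
    (huv : u < v) (hfix : ∀ x ∈ Finset.Ioc u v, σ x = x) : IsGeodesic (σ * swap u v) := by
  have h1 := cycleCount_mul_swap_le (σ * swap u v) u v
  rw [mul_assoc, swap_mul_self, mul_one] at h1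
  -- Joining two cycles loses at most one cycle of σ, so it suffices that γσ⁻¹ gains one.
  suffices h2 : cycleCount (finRotate (n + 1) * σ⁻¹) <
      cycleCount (finRotate (n + 1) * (σ * swap u v)⁻¹) by
    refine le_antisymm (cycleCount_add_le_of_long_cycle _) ?_
    unfold IsGeodesic at h
    lia
  have key : ∀ (τ : Perm (Fin (n + 1))) (f : Fin (n + 1) → ℚ),
      f ∈ fixedFunctions (finRotate (n + 1) * τ⁻¹) ↔ ∀ x, f (finRotate (n + 1) x) = f (τ x) := by
    intro τ f
    refine ⟨fun hf x => ?_, fun hf x => ?_⟩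
    · have := hf (τ x)
      simpa using this
    · rw [Perm.mul_apply, hf, ← Perm.mul_apply, mul_inv_cancel, Perm.one_apply]
  have hout : ∀ x, σ x ∈ Finset.Ioc u v ↔ x ∈ Finset.Ioc u v := fun x =>
    ⟨fun hx => by rwa [← σ.injective (hfix _ hx)], fun hx => by rwa [hfix x hx]⟩
  apply Submodule.finrank_lt_finrank_of_lt
  rw [SetLike.lt_iff_le_and_exists]
  constructor
  · intro f hf
    rw [key] at hf ⊢
    -- Since σ fixes (u, v], the values of f ∘ γ and of f have equal sums there. Shifting the latter
    -- sum by γ and cancelling the interior leaves f (γ u) = f (γ v).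
    have hsum : ∑ x ∈ Finset.Ioc u v, f (finRotate (n + 1) x) =
        ∑ x ∈ Finset.Ico u v, f (finRotate (n + 1) x) := by
      rw [sum_finRotate_Ico]
      exact Finset.sum_congr rfl fun x hx => by rw [hf, hfix x hx]
    rw [← Finset.Ioo_insert_right huv, ← Finset.Ioo_insert_left huv,
      Finset.sum_insert (by simp), Finset.sum_insert (by simp), add_left_inj] at hsum
    intro x
    rw [Perm.mul_apply, ← hf, swap_apply_def]
    split_ifs with h1 h2
    · rw [h1, hsum]
    · rw [h2, hsum]
    · rfl
  -- The indicator of (u, v] makes the inclusion strict: γ u lies in this arc and σ u does not.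
  · refine ⟨fun x => if x ∈ Finset.Ioc u v then 1 else 0, ?_, fun hf => ?_⟩
    · rw [key]
      intro x
      have := finRotate_mul_swap_mem_Ioc huv (swap u v x)
      rw [Perm.mul_apply, swap_apply_self] at this
      simp only [this, Perm.mul_apply, hout]
    · rw [key] at hf
      have h3 := ite_one_zero_inj.1 (hf u)
      have h4 : finRotate (n + 1) u ∈ Finset.Ioc u v := by
        have := finRotate_mul_swap_mem_Ioc huv v
        rw [Perm.mul_apply, swap_apply_right] at this
        exact this.2 (by simp [huv])
      have h5 : σ u ∉ Finset.Ioc u v := by simp [hout]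
      exact h5 (h3.1 h4)

/-- A relation without crossings. -/
def NonCrossingSetoid (r : Setoid (Fin (n + 1))) : Prop :=
  ∀ a₁ b₁ a₂ b₂ : Fin (n + 1), a₁ < b₁ → b₁ < a₂ → a₂ < b₂ → r a₁ a₂ → r b₁ b₂ → r a₁ b₁

/-- The equivalence relation in which a point is split off from its class. -/
def isolate (r : Setoid (Fin (n + 1))) (v : Fin (n + 1)) : Setoid (Fin (n + 1)) where
  r x y := x = y ∨ (r x y ∧ x ≠ v ∧ y ≠ v)
  iseqv :=
    { refl := fun _ => Or.inl rfl
      symm := by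
        rintro x y (rfl | ⟨h, hx, hy⟩)
        · exact Or.inl rfl
        · exact Or.inr ⟨r.symm h, hy, hx⟩
      trans := by
        rintro x y z (rfl | ⟨h, hx, hy⟩) (rfl | ⟨h', hx', hy'⟩)
        · exact Or.inl rfl
        · exact Or.inr ⟨h', hx', hy'⟩
        · exact Or.inr ⟨h, hx, hy⟩
        · exact Or.inr ⟨r.trans h h', hx, hy'⟩ }

theorem isolate_iff {r : Setoid (Fin (n + 1))} {v x y : Fin (n + 1)} :
    isolate r v x y ↔ x = y ∨ (r x y ∧ x ≠ v ∧ y ≠ v) := Iff.rfl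

theorem NonCrossingSetoid.isolate {r : Setoid (Fin (n + 1))} (h : NonCrossingSetoid r)
    (v : Fin (n + 1)) : NonCrossingSetoid (isolate r v) := by
  rintro a₁ b₁ a₂ b₂ h1 h2 h3 (rfl | ⟨ha, ha1, ha2⟩) (rfl | ⟨hb, hb1, hb2⟩)
  · order
  · order
  · order
  · exact Or.inr ⟨h _ _ _ _ h1 h2 h3 ha hb, ha1, hb1⟩

theorem isGeodesic_one : IsGeodesic (1 : Perm (Fin (n + 1))) := by
  have h : fixedFunctions (1 : Perm (Fin (n + 1))) = ⊤ := by
    ext f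
    simp [mem_fixedFunctions]
  rw [IsGeodesic, inv_one, mul_one, cycleCount_finRotate, cycleCount, h, finrank_top,
    Module.finrank_fintype_fun_eq_card, Fintype.card_fin]

-- Induction on the number of related pairs. For a related pair u < v at minimal distance, the
-- points strictly between are singletons. Isolating v and applying induction gives a permutation
-- fixing (u, v], and `IsGeodesic.mul_swap` joins v back to the class of u.
open Classical in
theorem exists_isGeodesic_aux (k : ℕ) (r : Setoid (Fin (n + 1)))
    (hk : (Finset.univ.filter fun x : Fin (n + 1) × Fin (n + 1) => r x.1 x.2).card ≤ k)
    (hr : NonCrossingSetoid r) :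
    ∃ σ : Perm (Fin (n + 1)), IsGeodesic σ ∧ fixedFunctions σ = classFunctions r := by
  induction k generalizing r with
  | zero =>
    have : ((0, 0) : Fin (n + 1) × Fin (n + 1)) ∈
        Finset.univ.filter fun x : Fin (n + 1) × Fin (n + 1) => r x.1 x.2 := by
      simp
    rw [Nat.le_zero, Finset.card_eq_zero] at hk
    simp [hk] at this
  | succ k ih =>
    by_cases htriv : ∀ x y, r x y → x = y
    · refine ⟨1, isGeodesic_one, ?_⟩
      ext f
      simp only [mem_fixedFunctions, Perm.one_apply, implies_true, true_iff]
      exact fun x y h => by rw [htriv x y h]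
    · push Not at htriv
      obtain ⟨x, y, hxy, hne⟩ := htriv
      have hex : ∃ d, ∃ u v : Fin (n + 1), u < v ∧ r u v ∧ (v : ℕ) - u = d := by
        rcases lt_or_gt_of_ne hne with h | h
        · exact ⟨_, x, y, h, hxy, rfl⟩
        · exact ⟨_, y, x, h, r.symm hxy, rfl⟩
      obtain ⟨u, v, huv, hruv, hd⟩ := Nat.find_spec hex
      have hmin : ∀ x y : Fin (n + 1), x < y → r x y → (v : ℕ) - u ≤ y - x := fun x y h1 h2 => by
        rw [hd]
        exact Nat.find_min' hex ⟨x, y, h1, h2, rfl⟩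
      -- A partner outside [u, v] would cross the pair (u, v) or join its class; one inside would
      -- give a closer related pair.
      have hsing : ∀ x y, u < x → x < v → r x y → x = y := by
        intro x y hux hxv hxy
        by_contra hne
        simp only [Fin.lt_def] at *
        have hu : r u x → False := fun h => by have := hmin u x hux h; lia
        rcases lt_trichotomy (y : ℕ) u with h | h | h
        · exact hu (r.trans (r.symm (hr y u x v h hux hxv (r.symm hxy) hruv)) (r.symm hxy))
        · exact hu (by rw [← Fin.ext h]; exact r.symm hxy)
        rcases lt_trichotomy (y : ℕ) v with h' | h' | h'
        · rcases lt_or_gt_of_ne (fun h => hne (Fin.ext h) : (x : ℕ) ≠ y) with h'' | h''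
          · have := hmin x y h'' hxy
            lia
          · have := hmin y x h'' (r.symm hxy)
            lia
        · rw [Fin.ext h'] at hxy
          exact hu (r.trans hruv (r.symm hxy))
        · exact hu (hr u x v y hux hxv h' hruv hxy)
      obtain ⟨σ, hσ, hF⟩ := ih (isolate r v) (by
        refine Nat.lt_succ_iff.1 (lt_of_lt_of_le (Finset.card_lt_card ?_) hk)
        rw [Finset.ssubset_iff_of_subset]
        · refine ⟨(u, v), by simpa using hruv, ?_⟩
          simp [isolate_iff, huv.ne]
        · intro z hz
          simp only [Finset.mem_filter, Finset.mem_univ, true_and, isolate_iff] at hz ⊢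
          rcases hz with hz | hz
          · rw [hz]
          · exact hz.1) (hr.isolate v)
      have hfix : ∀ x ∈ Finset.Ioc u v, σ x = x := by
        intro x hx
        rw [Finset.mem_Ioc] at hx
        have hmem : (fun y => if y = x then (1 : ℚ) else 0) ∈ fixedFunctions σ := by
          rw [hF]
          rintro y z (rfl | ⟨hyz, hy, hz⟩)
          · rfl
          · rcases hx.2.lt_or_eq with hlt | rfl
            · by_cases h1 : y = x
              · rw [h1] at hyz
                have h2 := hsing x z hx.1 hlt hyz
                rw [← h2, h1]
              · by_cases h2 : z = x
                · rw [h2] at hyz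
                  exact absurd (hsing x y hx.1 hlt (r.symm hyz)).symm h1
                · simp [h1, h2]
            · simp [hy, hz]
        have := mem_fixedFunctions.1 hmem x
        by_contra hne
        simp [hne] at this
      refine ⟨σ * swap u v, hσ.mul_swap huv hfix, ?_⟩
      ext f
      rw [mem_fixedFunctions_mul_swap (hfix v (by simp [huv])), hF]
      constructor
      · rintro ⟨hf, hfuv⟩ x y hxy
        have aux : ∀ y, y ≠ v → r v y → f v = f y := fun y hy h => by
          rw [← hfuv]
          exact hf u y (Or.inr ⟨r.trans hruv h, huv.ne, hy⟩)
        by_cases hx : x = v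
        · by_cases hy : y = v
          · rw [hx, hy]
          · rw [hx] at hxy ⊢
            exact aux y hy hxy
        · by_cases hy : y = v
          · rw [hy] at hxy ⊢
            exact (aux x hx (r.symm hxy)).symm
          · exact hf x y (Or.inr ⟨hxy, hx, hy⟩)
      · intro hf
        refine ⟨?_, hf u v hruv⟩
        rintro x y (rfl | h)
        · rfl
        · exact hf x y h.1

/-- Every non-crossing equivalence relation consists of the cycles of a geodesic permutation. -/
theorem exists_isGeodesic {r : Setoid (Fin (n + 1))} (hr : NonCrossingSetoid r) :
    ∃ σ : Perm (Fin (n + 1)), IsGeodesic σ ∧ ∀ x y, σ.SameCycle x y ↔ r x y := by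
  classical
  obtain ⟨σ, hσ, hF⟩ := exists_isGeodesic_aux _ r le_rfl hr
  refine ⟨σ, hσ, fun x y => ⟨fun h => ?_, fun h => ?_⟩⟩
  · have hmem : (fun z => if r x z then (1 : ℚ) else 0) ∈ fixedFunctions σ := by
      rw [hF]
      intro y z hyz
      simp only [show r x y ↔ r x z from ⟨fun h => r.trans h hyz, fun h => r.trans h (r.symm hyz)⟩]
    have := apply_eq_of_sameCycle (mem_fixedFunctions.1 hmem) h
    simpa [r.refl] using this
  · refine sameCycle_of_fixedFunctions fun f hf => ?_
    rw [hF] at hf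
    exact hf x y h

open Classical in
/-- The partition of `[p]` into the cycles of a permutation. -/
noncomputable def cyclePartition (σ : Perm (Fin (n + 1))) :
    Finpartition (Finset.univ : Finset (Fin (n + 1))) :=
  Finpartition.ofSetoid (Perm.SameCycle.setoid σ)

theorem mem_part_cyclePartition {σ : Perm (Fin (n + 1))} {x y : Fin (n + 1)} :
    y ∈ (cyclePartition σ).part x ↔ σ.SameCycle x y := by
  classical
  exact Finpartition.mem_part_ofSetoid_iff_rel

theorem card_parts_cyclePartition (σ : Perm (Fin (n + 1))) :
    (cyclePartition σ).parts.card = cycleCount σ := by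
  classical
  rw [cycleCount_eq_card, Nat.card_eq_fintype_card, ← Finset.card_univ]
  symm
  refine Finset.card_bij (fun q _ => Quotient.lift (cyclePartition σ).part ?_ q) ?_ ?_ ?_
  · intro x y h
    ext z
    rw [mem_part_cyclePartition, mem_part_cyclePartition]
    exact ⟨fun h' => (h.symm : σ.SameCycle y x).trans h', fun h' => (h : σ.SameCycle x y).trans h'⟩
  · intro q _
    induction q using Quotient.ind
    simp
  · intro q _ q' _ h
    induction q using Quotient.ind with | _ x
    induction q' using Quotient.ind with | _ y
    simp only [Quotient.lift_mk] at h
    apply Quotient.sound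
    have : y ∈ (cyclePartition σ).part x := by
      rw [h]
      simp
    exact mem_part_cyclePartition.1 this
  · intro V hV
    obtain ⟨x, hx⟩ := (cyclePartition σ).nonempty_of_mem_parts hV
    exact ⟨Quotient.mk _ x, Finset.mem_univ _, (cyclePartition σ).part_eq_of_mem hV hx⟩

open Classical in
/-- Non-crossing partitions without singletons correspond to geodesic permutations without fixed
points. -/
theorem sum_isGeodesic_eq_sum_nonCrossing {M : Type*} [AddCommMonoid M] (f : ℕ → M) :
    ∑ σ : Perm (Fin (n + 1)) with IsGeodesic σ ∧ ∀ x, σ x ≠ x, f (cycleCount σ) =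
      ∑ π ∈ nonCrossingNoSingletons (n + 1), f π.parts.card := by
  refine Finset.sum_bij (fun σ _ => cyclePartition σ) ?_ ?_ ?_ ?_
  · intro σ hσ
    simp only [Finset.mem_filter, Finset.mem_univ, true_and] at hσ
    simp only [nonCrossingNoSingletons, Finset.mem_filter, Finset.mem_univ, true_and]
    have hmem : ∀ V ∈ (cyclePartition σ).parts, ∀ x ∈ V, ∀ y, y ∈ V ↔ σ.SameCycle x y := by
      intro V hV x hx y
      rw [← (cyclePartition σ).part_eq_of_mem hV hx, mem_part_cyclePartition]
    refine ⟨fun a₁ b₁ a₂ b₂ h1 h2 h3 U hU V hV ha1 ha2 hb1 hb2 => ?_, fun V hV hcard => ?_⟩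
    · refine (cyclePartition σ).eq_of_mem_parts hU hV (a := b₁) ?_ hb1
      rw [hmem U hU a₁ ha1]
      exact hσ.1.sameCycle_of_crossing h1 h2 h3 ((hmem U hU _ ha1 _).1 ha2)
        ((hmem V hV _ hb1 _).1 hb2)
    · obtain ⟨x, rfl⟩ := Finset.card_eq_one.1 hcard
      refine hσ.2 x (Finset.mem_singleton.1 ?_)
      rw [hmem _ hV x (by simp)]
      exact Perm.sameCycle_apply_right.2 (Perm.SameCycle.refl σ x)
  · intro σ hσ τ hτ h
    simp only [Finset.mem_filter, Finset.mem_univ, true_and] at hσ hτ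
    refine hσ.1.eq_of_sameCycle hτ.1 fun x y => ?_
    rw [← mem_part_cyclePartition, h, mem_part_cyclePartition]
  · intro π hπ
    simp only [nonCrossingNoSingletons, Finset.mem_filter, Finset.mem_univ, true_and] at hπ
    have hself : ∀ x, x ∈ π.part x := fun x => π.mem_part (Finset.mem_univ x)
    let r : Setoid (Fin (n + 1)) := Setoid.ker π.part
    have hr : NonCrossingSetoid r := by
      intro a₁ b₁ a₂ b₂ h1 h2 h3 ha hb
      change π.part a₁ = π.part a₂ at ha
      change π.part b₁ = π.part b₂ at hb
      exact hπ.1 a₁ b₁ a₂ b₂ h1 h2 h3 _ (π.part_mem.2 (Finset.mem_univ a₁)) _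
        (π.part_mem.2 (Finset.mem_univ b₁)) (hself _) (ha ▸ hself _) (hself _) (hb ▸ hself _)
    obtain ⟨σ, hσ, hrel⟩ := exists_isGeodesic hr
    have hpart : ∀ x, (cyclePartition σ).part x = π.part x := by
      intro x
      ext y
      rw [mem_part_cyclePartition, hrel]
      change π.part x = π.part y ↔ _
      rw [π.mem_part_iff_part_eq_part (Finset.mem_univ _) (Finset.mem_univ _), eq_comm]
    refine ⟨σ, ?_, ?_⟩
    · simp only [Finset.mem_filter, Finset.mem_univ, true_and]
      refine ⟨hσ, fun x hx => hπ.2 _ (π.part_mem.2 (Finset.mem_univ x)) ?_⟩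
      rw [Finset.card_eq_one]
      refine ⟨x, ?_⟩
      rw [← hpart]
      ext y
      rw [mem_part_cyclePartition, Finset.mem_singleton]
      exact ⟨fun h => (h.eq_of_left hx).symm, fun h => h ▸ Perm.SameCycle.refl σ _⟩
    · have hsub : ∀ (ρ ρ' : Finpartition (Finset.univ : Finset (Fin (n + 1)))),
          (∀ x, ρ.part x = ρ'.part x) → ρ.parts ⊆ ρ'.parts := by
        intro ρ ρ' h V hV
        obtain ⟨x, hx⟩ := ρ.nonempty_of_mem_parts hV
        rw [← ρ.part_eq_of_mem hV hx, h]
        exact ρ'.part_mem.2 (Finset.mem_univ x)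
      exact Finpartition.ext ((hsub _ _ hpart).antisymm (hsub _ _ fun x => (hpart x).symm))
  · intro σ _
    rw [card_parts_cyclePartition]

end NonCrossing

/-! ### Moments of complex Gaussian families. -/

section GaussianMoments

open scoped Nat ComplexConjugate

instance isProbabilityMeasure_stdComplexGaussian : IsProbabilityMeasure stdComplexGaussian :=
  Measure.isProbabilityMeasure_map Complex.measurableEquivRealProd.symm.measurable.aemeasurable

theorem integral_stdComplexGaussian (f : ℂ → ℂ) :
    ∫ z, f z ∂stdComplexGaussian =
      ∫ z : ℂ, ((Real.pi⁻¹ * Real.exp (-‖z‖ ^ (2 : ℝ)) : ℝ) : ℂ) * f z := by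
  have h1 : stdComplexGaussian = ((gaussianReal 0 (1 / 2)).prod (gaussianReal 0 (1 / 2))).map
      Complex.measurableEquivRealProd.symm := rfl
  have hmp := Complex.volume_preserving_equiv_real_prod.symm
  rw [h1, integral_map_equiv, gaussianReal_of_var_ne_zero _ (by simp),
    prod_withDensity (measurable_gaussianPDF _ _) (measurable_gaussianPDF _ _),
    integral_withDensity_eq_integral_toReal_smul
      (by have := measurable_gaussianPDF 0 (1 / 2); fun_prop)
      (by
        refine Eventually.of_forall fun z => ?_
        simp [gaussianPDF, ENNReal.mul_lt_top_iff]),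
    ← hmp.integral_comp' (g := fun z : ℂ =>
      ((Real.pi⁻¹ * Real.exp (-‖z‖ ^ (2 : ℝ)) : ℝ) : ℂ) * f z)]
  refine integral_congr_ae (Eventually.of_forall fun z => ?_)
  have h2 : (gaussianPDF 0 (1 / 2) z.1 * gaussianPDF 0 (1 / 2) z.2).toReal =
      Real.pi⁻¹ * Real.exp (-‖Complex.measurableEquivRealProd.symm z‖ ^ (2 : ℝ)) := by
    rw [ENNReal.toReal_mul, toReal_gaussianPDF, toReal_gaussianPDF, gaussianPDFReal,
      gaussianPDFReal, Real.rpow_two, ← Complex.normSq_eq_norm_sq, Complex.normSq_apply]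
    have h3 : (Complex.measurableEquivRealProd.symm z).re = z.1 := rfl
    have h4 : (Complex.measurableEquivRealProd.symm z).im = z.2 := rfl
    rw [h3, h4, mul_mul_mul_comm, ← Real.exp_add]
    congr 1
    · rw [← mul_inv, Real.mul_self_sqrt (by positivity)]
      norm_num
      ring
    · congr 1
      simp
      ring
  simp only [h2, Complex.real_smul]

theorem integral_pow_mul_conj_pow_stdComplexGaussian (a b : ℕ) :
    ∫ z, z ^ a * conj z ^ b ∂stdComplexGaussian = if a = b then (a ! : ℂ) else 0 := by
  rw [integral_stdComplexGaussian]
  split_ifs with hab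
  · subst hab
    have h1 : ∀ z : ℂ, ((Real.pi⁻¹ * Real.exp (-‖z‖ ^ (2 : ℝ)) : ℝ) : ℂ) * (z ^ a * conj z ^ a) =
        ((Real.pi⁻¹ * (‖z‖ ^ ((2 * a : ℕ) : ℝ) * Real.exp (-‖z‖ ^ (2 : ℝ))) : ℝ) : ℂ) := by
      intro z
      rw [← mul_pow, Complex.mul_conj, Complex.normSq_eq_norm_sq, Real.rpow_natCast, pow_mul]
      push_cast
      ring
    simp only [h1]
    rw [integral_complex_ofReal, integral_const_mul, Complex.integral_rpow_mul_exp_neg_rpow one_le_two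
      (by have : (0 : ℝ) ≤ ((2 * a : ℕ) : ℝ) := Nat.cast_nonneg _
          linarith)]
    have h2 : (((2 * a : ℕ) : ℝ) + 2) / 2 = (a : ℝ) + 1 := by
      push_cast
      ring
    rw [h2, Real.Gamma_nat_eq_factorial]
    have : Real.pi ≠ 0 := Real.pi_ne_zero
    push_cast
    have : (Real.pi : ℂ) ≠ 0 := by exact_mod_cast this
    field_simp
  · have hne : ((a : ℝ) - b) ≠ 0 := sub_ne_zero.2 (by exact_mod_cast hab)
    -- Rotation by π/(a − b) preserves the Gaussian weight and multiplies z^a z̄^b by e^(iπ) = −1,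
    -- so the integral equals its own negative.
    let u : Circle := Circle.exp (Real.pi / (a - b))
    have hu : (u : ℂ) ^ a * conj (u : ℂ) ^ b = -1 := by
      have hneC : ((a : ℂ) - b) ≠ 0 := by exact_mod_cast hne
      rw [← Circle.coe_inv_eq_conj, ← Circle.exp_neg, Circle.coe_exp, Circle.coe_exp,
        ← Complex.exp_nat_mul, ← Complex.exp_nat_mul, ← Complex.exp_add, ← Complex.exp_pi_mul_I]
      congr 1
      push_cast
      field_simp
      ring
    have hinv := (rotation u).measurePreserving.integral_comp
      (rotation u).toHomeomorph.measurableEmbedding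
      (fun z : ℂ => ((Real.pi⁻¹ * Real.exp (-‖z‖ ^ (2 : ℝ)) : ℝ) : ℂ) * (z ^ a * conj z ^ b))
    have h3 : ∀ z : ℂ, ((Real.pi⁻¹ * Real.exp (-‖rotation u z‖ ^ (2 : ℝ)) : ℝ) : ℂ) *
        (rotation u z ^ a * conj (rotation u z) ^ b) =
        -(((Real.pi⁻¹ * Real.exp (-‖z‖ ^ (2 : ℝ)) : ℝ) : ℂ) * (z ^ a * conj z ^ b)) := by
      intro z
      rw [LinearIsometryEquiv.norm_map, rotation_apply, map_mul, mul_pow, mul_pow,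
        mul_mul_mul_comm, hu]
      ring
    simp only [h3, integral_neg] at hinv
    exact self_eq_neg.1 hinv.symm

variable {Ω : Type*} [MeasurableSpace Ω] {μ : Measure Ω}

/-- A random variable all of whose absolute moments are finite. -/
def HasAllMoments (f : Ω → ℂ) (μ : Measure Ω) : Prop := ∀ q : ℕ, MemLp f q μ

namespace HasAllMoments

variable {f g : Ω → ℂ}

theorem integrable (hf : HasAllMoments f μ) : Integrable f μ := by
  rw [← memLp_one_iff_integrable]
  exact_mod_cast hf 1

theorem mul (hf : HasAllMoments f μ) (hg : HasAllMoments g μ) :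
    HasAllMoments (fun ω => f ω * g ω) μ := fun q => by
  have : ENNReal.HolderTriple (2 * q : ℕ) (2 * q : ℕ) q := ⟨by
    rw [Nat.cast_mul, ENNReal.mul_inv (Or.inl (by simp)) (Or.inl (by simp)), Nat.cast_ofNat,
      ← add_mul, ENNReal.inv_two_add_inv_two, one_mul]⟩
  exact (hg (2 * q)).mul' (hf (2 * q))

theorem add (hf : HasAllMoments f μ) (hg : HasAllMoments g μ) :
    HasAllMoments (fun ω => f ω + g ω) μ := fun q => (hf q).add (hg q)

theorem sub (hf : HasAllMoments f μ) (hg : HasAllMoments g μ) :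
    HasAllMoments (fun ω => f ω - g ω) μ := fun q => (hf q).sub (hg q)

theorem star (hf : HasAllMoments f μ) : HasAllMoments (fun ω => conj (f ω)) μ := fun q =>
  (hf q).star

theorem const [IsFiniteMeasure μ] (c : ℂ) : HasAllMoments (fun _ => c) μ := fun _ =>
  memLp_const c

theorem sum {ι : Type*} {s : Finset ι} {f : ι → Ω → ℂ} (hf : ∀ i ∈ s, HasAllMoments (f i) μ) :
    HasAllMoments (fun ω => ∑ i ∈ s, f i ω) μ := fun q =>
  memLp_finsetSum s fun i hi => hf i hi q

theorem prod [IsFiniteMeasure μ] {ι : Type*} {s : Finset ι} {f : ι → Ω → ℂ}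
    (hf : ∀ i ∈ s, HasAllMoments (f i) μ) : HasAllMoments (fun ω => ∏ i ∈ s, f i ω) μ := by
  classical
  induction s using Finset.induction_on with
  | empty => simpa using const 1
  | insert i s his ih =>
    simp only [Finset.prod_insert his]
    exact (hf i (Finset.mem_insert_self i s)).mul
      (ih fun j hj => hf j (Finset.mem_insert_of_mem hj))

theorem comp_measurePreserving {Ω' : Type*} [MeasurableSpace Ω'] {ν : Measure Ω'} {F : Ω' → Ω}
    (hf : HasAllMoments f μ) (hF : MeasurePreserving F ν μ) :
    HasAllMoments (fun ω => f (F ω)) ν := fun q => (hf q).comp_measurePreserving hF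

end HasAllMoments

theorem hasAllMoments_stdComplexGaussian : HasAllMoments (fun z => z) stdComplexGaussian := by
  intro q
  have hre : MemLp (fun x : ℝ × ℝ => x.1) q
      ((gaussianReal 0 (1 / 2)).prod (gaussianReal 0 (1 / 2))) :=
    (memLp_id_gaussianReal (μ := 0) (v := 1 / 2) q).comp_measurePreserving measurePreserving_fst
  have him : MemLp (fun x : ℝ × ℝ => x.2) q
      ((gaussianReal 0 (1 / 2)).prod (gaussianReal 0 (1 / 2))) :=
    (memLp_id_gaussianReal (μ := 0) (v := 1 / 2) q).comp_measurePreserving measurePreserving_snd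
  refine (memLp_map_measure_iff aestronglyMeasurable_id
    Complex.measurableEquivRealProd.symm.measurable.aemeasurable).2 ?_
  refine (hre.ofReal (K := ℂ) |>.add ((him.ofReal (K := ℂ)).const_mul Complex.I)).congr_norm
    Complex.measurableEquivRealProd.symm.measurable.aestronglyMeasurable
    (Eventually.of_forall fun x => ?_)
  congr 1
  simp only [Pi.add_apply, Function.comp_apply]
  rw [mul_comm]
  exact (Complex.mk_eq_add_mul_I _ _).symm

/-- A finite family of random variables with the moments of independent standard complex
Gaussians. -/
structure IsGaussianFamily {I : Type*} [Fintype I] (μ : Measure Ω) (g : I → Ω → ℂ) : Prop where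
  hasAllMoments : ∀ t, HasAllMoments (g t) μ
  moment : ∀ a b : I → ℕ, ∫ ω, ∏ t, (g t ω ^ a t * conj (g t ω) ^ b t) ∂μ =
    ∏ t, if a t = b t then ((a t)! : ℂ) else 0

theorem isGaussianFamily_gaussianMatrix (m k : Type*) [Fintype m] [Fintype k] :
    IsGaussianFamily (gaussianMatrix m k) (fun (t : m × k) (x : m → k → ℂ) => x t.1 t.2) where
  hasAllMoments t := hasAllMoments_stdComplexGaussian.comp_measurePreserving
    ((measurePreserving_eval (fun _ : k => stdComplexGaussian) t.2).comp
      (measurePreserving_eval (fun _ : m => Measure.pi fun _ : k => stdComplexGaussian) t.1))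
  moment a b := by
    simp only [Fintype.prod_prod_type, gaussianMatrix]
    rw [integral_fintype_prod_eq_prod
      (fun (i : m) (y : k → ℂ) => ∏ j, (y j ^ a (i, j) * conj (y j) ^ b (i, j)))]
    refine Finset.prod_congr rfl fun i _ => ?_
    rw [integral_fintype_prod_eq_prod
      (fun (j : k) (z : ℂ) => z ^ a (i, j) * conj z ^ b (i, j))]
    exact Finset.prod_congr rfl fun j _ => integral_pow_mul_conj_pow_stdComplexGaussian _ _

instance (m k : Type*) [Fintype m] [Fintype k] : IsProbabilityMeasure (gaussianMatrix m k) := by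
  unfold gaussianMatrix
  infer_instance

theorem IsGaussianFamily.prod {I Ω' : Type*} [Fintype I] [MeasurableSpace Ω'] {ν : Measure Ω'}
    [IsProbabilityMeasure μ] [IsProbabilityMeasure ν] {g : I → Ω → ℂ} {h : I → Ω' → ℂ}
    (hg : IsGaussianFamily μ g) (hh : IsGaussianFamily ν h) :
    IsGaussianFamily (μ.prod ν)
      (fun (t : Bool × I) (ω : Ω × Ω') => if t.1 then h t.2 ω.2 else g t.2 ω.1) where
  hasAllMoments t := by
    rcases t with ⟨_ | _, t⟩
    · simpa using (hg.hasAllMoments t).comp_measurePreserving measurePreserving_fst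
    · simpa using (hh.hasAllMoments t).comp_measurePreserving measurePreserving_snd
  moment a b := by
    simp only [Fintype.prod_prod_type, Fintype.prod_bool, if_true, Bool.false_eq_true, if_false]
    rw [← hg.moment (fun t => a (false, t)) (fun t => b (false, t)),
      ← hh.moment (fun t => a (true, t)) (fun t => b (true, t)), mul_comm, ← integral_prod_mul]
    exact integral_congr_ae (Eventually.of_forall fun ω => mul_comm _ _)

end GaussianMoments

/-! ### Wick's formula, plain and centred. -/

section Wick

open Equiv
open scoped Nat ComplexConjugate

variable {Ω : Type*} [MeasurableSpace Ω] {μ : Measure Ω}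

/-- The right-hand side is the Gaussian moment in which label t occurs as often as the fibres of i
and j over t have points; this turns the moment formula into a count of pairings. -/
theorem card_perm_comp_eq {X I : Type*} [Fintype X] [DecidableEq X] [Fintype I] [DecidableEq I]
    (i j : X → I) : Nat.card {σ : Perm X // ∀ q, i (σ q) = j q} =
      ∏ t, if Fintype.card {q // i q = t} = Fintype.card {q // j q = t} then
        (Fintype.card {q // i q = t})! else 0 := by
  by_cases h : ∀ t, Fintype.card {q // i q = t} = Fintype.card {q // j q = t}
  · have he : ∀ t, Nonempty ({q // j q = t} ≃ {q // i q = t}) := fun t =>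
      Fintype.card_eq.1 (h t).symm
    let σ₀ : Perm X := Equiv.ofFiberEquiv fun t => (he t).some
    have hσ₀ : ∀ q, i (σ₀ q) = j q := Equiv.ofFiberEquiv_map _
    simp only [h, if_true]
    simp only [← h]
    rw [← DomMulAct.stabilizer_card, ← Nat.card_eq_fintype_card]
    -- The solutions form a coset of the stabiliser of i, whose order is the product of the
    -- factorials of the fibre sizes.
    refine Nat.card_congr ((Equiv.mulRight σ₀⁻¹).subtypeEquiv fun σ => ?_)
    simp only [funext_iff, Function.comp_apply, Equiv.coe_mulRight, Perm.mul_apply]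
    constructor
    · intro hσ q
      rw [hσ, ← hσ₀, ← Perm.mul_apply, mul_inv_cancel, Perm.one_apply]
    · intro hσ q
      have := hσ (σ₀ q)
      rwa [hσ₀, Perm.coe_inv, Equiv.symm_apply_apply] at this
  · push Not at h
    obtain ⟨t, ht⟩ := h
    rw [Finset.prod_eq_zero (Finset.mem_univ t) (by simp [ht]), Nat.card_eq_zero]
    refine Or.inl ⟨fun ⟨σ, hσ⟩ => ?_⟩
    exact ht (Fintype.card_congr (σ.symm.subtypeEquiv fun q => by simp [← hσ]))

variable {I : Type*} [Fintype I] {g : I → Ω → ℂ}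

/-- Wick's formula. -/
theorem IsGaussianFamily.wick (hg : IsGaussianFamily μ g) {X : Type*} [Fintype X]
    (i j : X → I) : ∫ ω, ∏ q, (g (i q) ω * conj (g (j q) ω)) ∂μ =
      (Nat.card {σ : Perm X // ∀ q, i (σ q) = j q} : ℂ) := by
  classical
  rw [card_perm_comp_eq]
  push_cast
  rw [← hg.moment]
  refine integral_congr_ae (Eventually.of_forall fun ω => ?_)
  simp only [Finset.prod_mul_distrib]
  rw [← Fintype.prod_fiberwise' i (fun t => g t ω),
    ← Fintype.prod_fiberwise' j (fun t => conj (g t ω))]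
  simp

-- The deltas over t are the weight of pairing each of these factors with itself, so multiplying by
-- them selects the pairings that are the identity over t.
open Classical in
theorem IsGaussianFamily.wick_subset (hg : IsGaussianFamily μ g) {R : Type*} [Fintype R]
    (i j : R × Bool → I) (t : Finset R) :
    (∏ r ∈ t, ∏ ε, if i (r, ε) = j (r, ε) then (1 : ℂ) else 0) *
      ∫ ω, ∏ r ∈ Finset.univ \ t, ∏ ε, (g (i (r, ε)) ω * conj (g (j (r, ε)) ω)) ∂μ =
    (Nat.card {σ : Perm (R × Bool) // (∀ q, i (σ q) = j q) ∧
      ∀ r ∈ t, ∀ ε, σ (r, ε) = (r, ε)} : ℂ) := by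
  by_cases h : ∀ r ∈ t, ∀ ε, i (r, ε) = j (r, ε)
  · rw [Finset.prod_eq_one fun r hr => Finset.prod_eq_one fun ε _ => by simp [h r hr ε], one_mul]
    have hprod : ∀ ω, ∏ r ∈ Finset.univ \ t, ∏ ε, (g (i (r, ε)) ω * conj (g (j (r, ε)) ω)) =
        ∏ q : {q : R × Bool // q.1 ∉ t}, (g (i q) ω * conj (g (j q) ω)) := by
      intro ω
      rw [← Finset.prod_product' (f := fun r ε => g (i (r, ε)) ω * conj (g (j (r, ε)) ω))]
      exact Finset.prod_subtype _ (by simp) _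
    simp only [hprod]
    rw [hg.wick (fun q : {q : R × Bool // q.1 ∉ t} => i q) (fun q => j q)]
    congr 1
    refine Nat.card_congr (((Perm.subtypeEquivSubtypePerm fun q : R × Bool => q.1 ∉ t).subtypeEquiv
      (q := fun σ => ∀ q, i (σ.1 q) = j q) fun τ => ?_).trans
      ((Equiv.subtypeSubtypeEquivSubtypeInter
        (fun σ : Perm (R × Bool) => ∀ a, ¬ a.1 ∉ t → σ a = a) fun σ => ∀ q, i (σ q) = j q).trans
        (Equiv.subtypeEquivRight fun σ => ?_)))
    · constructor
      · intro hτ q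
        by_cases hq : q.1 ∉ t
        · rw [Perm.subtypeEquivSubtypePerm_apply_of_mem (p := fun q : R × Bool => q.1 ∉ t) τ hq]
          exact hτ ⟨q, hq⟩
        · rw [Perm.subtypeEquivSubtypePerm_apply_of_not_mem (p := fun q : R × Bool => q.1 ∉ t) τ hq]
          exact h q.1 (not_not.1 hq) q.2
      · intro hτ q
        have := hτ q
        rwa [Perm.subtypeEquivSubtypePerm_apply_of_mem (p := fun q : R × Bool => q.1 ∉ t) τ q.2]
          at this
    · simp only [not_not, Prod.forall]
      exact ⟨fun ⟨h1, h2⟩ => ⟨h2, fun r hr ε => h1 r ε hr⟩,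
        fun ⟨h2, h1⟩ => ⟨fun r ε hr => h1 r hr ε, h2⟩⟩
  · push Not at h
    obtain ⟨r, hr, ε, hne⟩ := h
    rw [Finset.prod_eq_zero hr (Finset.prod_eq_zero (Finset.mem_univ ε) (by simp [hne])), zero_mul]
    symm
    rw [Nat.cast_eq_zero, Nat.card_eq_zero]
    refine Or.inl ⟨fun ⟨σ, h1, h2⟩ => ?_⟩
    exact hne (by rw [← h1, h2 r hr])

open Classical in
/-- Wick's formula for products of centred factors: the pairings with an internally paired factor
cancel. -/
theorem IsGaussianFamily.wick_centred [IsProbabilityMeasure μ] (hg : IsGaussianFamily μ g)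
    {R : Type*} [Fintype R] (i j : R × Bool → I) :
    ∫ ω, ∏ r, (∏ ε, (g (i (r, ε)) ω * conj (g (j (r, ε)) ω)) -
      ∏ ε, if i (r, ε) = j (r, ε) then (1 : ℂ) else 0) ∂μ =
    (Nat.card {σ : Perm (R × Bool) // (∀ q, i (σ q) = j q) ∧
      ∀ r, ¬ ∀ ε, σ (r, ε) = (r, ε)} : ℂ) := by
  have hA : ∀ t : Finset R, HasAllMoments (fun ω =>
      ∏ r ∈ t, ∏ ε, (g (i (r, ε)) ω * conj (g (j (r, ε)) ω))) μ := fun t =>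
    HasAllMoments.prod fun r _ => HasAllMoments.prod fun ε _ =>
      (hg.hasAllMoments _).mul (hg.hasAllMoments _).star
  simp only [Finset.prod_sub]
  rw [integral_finsetSum _ fun t _ => (((hA (Finset.univ \ t)).integrable.const_mul _).mul_const _)]
  have hterm : ∀ t : Finset R, ∫ ω, (-1) ^ t.card *
      (∏ r ∈ Finset.univ \ t, ∏ ε, (g (i (r, ε)) ω * conj (g (j (r, ε)) ω))) *
      ∏ r ∈ t, ∏ ε, (if i (r, ε) = j (r, ε) then (1 : ℂ) else 0) ∂μ =
      ∑ σ : Perm (R × Bool), if (∀ q, i (σ q) = j q) ∧ ∀ r ∈ t, ∀ ε, σ (r, ε) = (r, ε) then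
        (-1 : ℂ) ^ t.card else 0 := by
    intro t
    rw [integral_mul_const, integral_const_mul, mul_assoc, mul_comm (∫ _, _ ∂μ), hg.wick_subset,
      Nat.card_eq_fintype_card, Fintype.card_subtype, ← Finset.sum_filter, Finset.sum_const, nsmul_eq_mul, mul_comm]
  rw [Finset.sum_congr rfl fun t _ => hterm t, Finset.sum_comm,
    Nat.card_eq_fintype_card, Fintype.card_subtype, Finset.card_filter, Nat.cast_sum]
  refine Finset.sum_congr rfl fun σ _ => ?_
  by_cases hσ : ∀ q, i (σ q) = j q
  -- σ is counted once, with sign, for every t ⊆ F. The alternating sum vanishes unless F is empty.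
  · let F : Finset R := Finset.univ.filter fun r => ∀ ε, σ (r, ε) = (r, ε)
    have h1 : ∀ t ∈ (Finset.univ : Finset R).powerset,
        (if (∀ q, i (σ q) = j q) ∧ ∀ r ∈ t, ∀ ε, σ (r, ε) = (r, ε) then (-1 : ℂ) ^ t.card else 0) =
          if t ∈ F.powerset then (-1 : ℂ) ^ t.card else 0 := by
      intro t _
      refine if_congr ?_ rfl rfl
      simp [hσ, F, Finset.subset_iff]
    rw [Finset.sum_congr rfl h1, Finset.powerset_univ, Finset.sum_ite_mem, Finset.univ_inter]
    have h2 := congrArg (Int.cast : ℤ → ℂ) (Finset.sum_powerset_neg_one_pow_card (x := F))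
    push_cast at h2
    rw [h2]
    push_cast
    refine if_congr ?_ rfl rfl
    simp [hσ, F, Finset.filter_eq_empty_iff]
  · simp only [hσ, false_and, if_false, Finset.sum_const_zero, Nat.cast_zero]

end Wick

/-! ### Traces of powers as sums over cyclic index sequences. -/

section Trace

variable {κ : Type*} [Fintype κ] [DecidableEq κ]

/-- The free last factor N serves the induction: one M at a time is absorbed into it. -/
theorem Matrix.trace_pow_mul_eq_sum {R : Type*} [CommRing R] (M : Matrix κ κ R) (n : ℕ)
    (N : Matrix κ κ R) : (M ^ n * N).trace = ∑ c : Fin (n + 1) → κ,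
      (∏ r : Fin n, M (c r.castSucc) (c r.succ)) * N (c (Fin.last n)) (c 0) := by
  induction n generalizing N with
  | zero =>
    simp only [pow_zero, one_mul, Matrix.trace, Matrix.diag, Finset.univ_eq_empty,
      Finset.prod_empty]
    exact Fintype.sum_equiv (Equiv.funUnique (Fin 1) κ).symm _ _ fun _ => rfl
  | succ n ih =>
    rw [pow_succ, mul_assoc, ih, ← (Fin.snocEquiv fun _ : Fin (n + 2) => κ).sum_comp, Fintype.sum_prod_type,
      Finset.sum_comm]
    refine Finset.sum_congr rfl fun c _ => ?_
    rw [Matrix.mul_apply, Finset.mul_sum]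
    refine Finset.sum_congr rfl fun x _ => ?_
    rw [Fin.prod_univ_castSucc]
    simp only [Fin.snocEquiv_apply, Fin.snoc_castSucc, Fin.succ_last, Fin.snoc_last,
      Fin.succ_castSucc]
    have h0 : (Fin.snoc c x : Fin (n + 2) → κ) 0 = c 0 :=
      Fin.snoc_castSucc (α := fun _ => κ) x c 0
    rw [h0, mul_assoc]

theorem Matrix.trace_pow_succ_eq_sum {R : Type*} [CommRing R] (M : Matrix κ κ R) (n : ℕ) :
    (M ^ (n + 1)).trace =
      ∑ c : Fin (n + 1) → κ, ∏ r, M (c r) (c (finRotate (n + 1) r)) := by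
  rw [pow_succ, Matrix.trace_pow_mul_eq_sum]
  refine Finset.sum_congr rfl fun c _ => ?_
  rw [Fin.prod_univ_castSucc, finRotate_last]
  congr 1
  refine Finset.prod_congr rfl fun r _ => ?_
  congr 2
  rw [finRotate_apply, Fin.coeSucc_eq_succ]

end Trace

theorem entanglementSwapping_apply {d₁ d₂ : ℕ}
    (W₁ W₂ : Matrix (Fin d₁ × Fin d₂) (Fin d₁ × Fin d₂) ℂ) (a b : Fin d₂ × Fin d₂) :
    entanglementSwapping W₁ W₂ a b =
      1 / (d₁ : ℂ) * ∑ x, ∑ y, W₁ (x, a.1) (y, b.1) * W₂ (x, a.2) (y, b.2) := by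
  have hbell : ∀ u v : Fin d₁ × Fin d₁,
      bellProjection d₁ u v = if u.1 = u.2 ∧ v.1 = v.2 then 1 else 0 := by
    rintro ⟨u, u'⟩ ⟨v, v'⟩
    simp only [bellProjection, Matrix.sum_apply, Matrix.kroneckerMap_apply, Matrix.single_apply]
    by_cases hu : u = u' <;> by_cases hv : v = v'
    · subst hu hv
      rw [Finset.sum_eq_single u, Finset.sum_eq_single v] <;> simp +contextual
    all_goals
      simp only [hu, hv, and_false, false_and, if_false]
      refine Finset.sum_eq_zero fun i _ => Finset.sum_eq_zero fun j _ => ?_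
      grind
  rw [entanglementSwapping, Matrix.smul_apply, smul_eq_mul, partialTraceLeft, Matrix.of_apply]
  congr 1
  simp only [Matrix.mul_apply, Fintype.sum_prod_type, Matrix.kroneckerMap_apply, hbell,
    tensorRegrouped, Matrix.reindex_apply, Matrix.submatrix_apply, Equiv.prodProdProdComm_symm,
    Equiv.prodProdProdComm_apply, Matrix.one_apply, Prod.ext_iff]
  refine Finset.sum_congr rfl fun x _ => ?_
  rw [Finset.sum_eq_single x (fun y _ hy => by simp [Ne.symm hy]) (by simp)]
  refine Finset.sum_congr rfl fun y _ => ?_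
  rw [Finset.sum_eq_single y (fun z _ hz => by simp [Ne.symm hz]) (by simp)]
  rw [Finset.sum_eq_single b.1 (fun z _ hz => by simp [hz]) (by simp)]
  rw [Finset.sum_eq_single b.2 (fun z _ hz => by simp [hz]) (by simp)]
  simp

/-! ### Expansion of the moments over pairings. -/

section Expansion

open Equiv
open scoped ComplexConjugate

variable {Ω T : Type*} {d₁ d₂ s : ℕ}

/-- The Gram matrix of one member of a family of random matrices. -/
def gramMatrix (g : T × ((Fin d₁ × Fin d₂) × Fin s) → Ω → ℂ) (t : T) (ω : Ω) :
    Matrix (Fin d₁ × Fin d₂) (Fin d₁ × Fin d₂) ℂ :=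
  Matrix.of fun u v => ∑ k, g (t, (u, k)) ω * conj (g (t, (v, k)) ω)

/-- The label of an unconjugated Gaussian in the expansion of the moments. -/
def rowLabel {R : Type*} (e : Bool → T) (a : R → Bool → Fin d₂)
    (y : R → Fin d₁ × Fin d₁ × (Bool → Fin s)) (q : R × Bool) :
    T × ((Fin d₁ × Fin d₂) × Fin s) :=
  (e q.2, (((y q.1).1, a q.1 q.2), (y q.1).2.2 q.2))

open Classical in
theorem rescaledSwapping_gramMatrix_apply (hd₁ : d₁ ≠ 0) (hd₂ : d₂ ≠ 0) (hs : s ≠ 0)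
    (g : T × ((Fin d₁ × Fin d₂) × Fin s) → Ω → ℂ) (e : Bool → T) (ω : Ω) (a b : Bool → Fin d₂) :
    rescaledSwapping s (gramMatrix g (e false) ω) (gramMatrix g (e true) ω)
      (a false, a true) (b false, b true) =
    1 / ((d₁ : ℂ) * d₂ * s) * ∑ y : Fin d₁ × Fin d₁ × (Bool → Fin s),
      (∏ ε, (g (e ε, ((y.1, a ε), y.2.2 ε)) ω * conj (g (e ε, ((y.2.1, b ε), y.2.2 ε)) ω)) -
        ∏ ε, if (e ε, ((y.1, a ε), y.2.2 ε)) = (e ε, ((y.2.1, b ε), y.2.2 ε)) then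
          (1 : ℂ) else 0) := by
  have hW : ∀ x y : Fin d₁, gramMatrix g (e false) ω (x, a false) (y, b false) *
      gramMatrix g (e true) ω (x, a true) (y, b true) = ∑ k : Bool → Fin s,
        ∏ ε, (g (e ε, ((x, a ε), k ε)) ω * conj (g (e ε, ((y, b ε), k ε)) ω)) := by
    intro x y
    rw [← Fintype.prod_sum (fun ε k => g (e ε, ((x, a ε), k)) ω * conj (g (e ε, ((y, b ε), k)) ω)),
      Fintype.prod_bool, mul_comm]
    rfl
  -- The subtracted identity is written as a sum of deltas over the same indices; d₁s²/(d₁d₂s) =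
  -- s/d₂ is its coefficient in `Z`.
  have hone : ∑ y : Fin d₁ × Fin d₁ × (Bool → Fin s),
      (∏ ε, if (e ε, ((y.1, a ε), y.2.2 ε)) = (e ε, ((y.2.1, b ε), y.2.2 ε)) then
          (1 : ℂ) else 0) =
      (d₁ : ℂ) * (s : ℂ) ^ 2 * (1 : Matrix (Fin d₂ × Fin d₂) (Fin d₂ × Fin d₂) ℂ)
        (a false, a true) (b false, b true) := by
    have h1 : ∀ y : Fin d₁ × Fin d₁ × (Bool → Fin s),
        (∏ ε, if (e ε, ((y.1, a ε), y.2.2 ε)) = (e ε, ((y.2.1, b ε), y.2.2 ε)) then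
          (1 : ℂ) else 0) = if y.1 = y.2.1 then
            (1 : Matrix (Fin d₂ × Fin d₂) (Fin d₂ × Fin d₂) ℂ)
              (a false, a true) (b false, b true) else 0 := by
      intro y
      rw [Fintype.prod_bool, Matrix.one_apply]
      simp only [Prod.mk.injEq, true_and, and_true]
      by_cases h1 : y.1 = y.2.1 <;> by_cases h2 : a false = b false <;>
        by_cases h3 : a true = b true <;> simp [h1, h2, h3]
    calc _ = ∑ x : Fin d₁, ∑ y : Fin d₁, ∑ _k : Bool → Fin s, if x = y then
            (1 : Matrix (Fin d₂ × Fin d₂) (Fin d₂ × Fin d₂) ℂ)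
              (a false, a true) (b false, b true) else 0 := by
          rw [Fintype.sum_prod_type]
          refine Finset.sum_congr rfl fun x _ => ?_
          rw [Fintype.sum_prod_type]
          exact Finset.sum_congr rfl fun y _ => Finset.sum_congr rfl fun k _ => h1 (x, y, k)
      _ = _ := by
          simp only [Finset.sum_const, Finset.card_univ, Fintype.card_fun, Fintype.card_bool,
            Fintype.card_fin, nsmul_eq_mul, mul_ite, mul_zero, Finset.sum_ite_eq, Finset.mem_univ,
            if_true]
          push_cast
          ring
  have h1 : (d₁ : ℂ) ≠ 0 := by exact_mod_cast hd₁
  have h2 : (d₂ : ℂ) ≠ 0 := by exact_mod_cast hd₂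
  have h3 : (s : ℂ) ≠ 0 := by exact_mod_cast hs
  rw [rescaledSwapping, Matrix.smul_apply, Matrix.sub_apply, Matrix.smul_apply, Matrix.smul_apply,
    entanglementSwapping_apply, Finset.sum_sub_distrib, hone]
  simp only [hW, Fintype.sum_prod_type, smul_eq_mul]
  field_simp

variable [MeasurableSpace Ω] {μ : Measure Ω}

theorem IsGaussianFamily.hasAllMoments_gramMatrix [Fintype T]
    {g : T × ((Fin d₁ × Fin d₂) × Fin s) → Ω → ℂ}
    (hg : IsGaussianFamily μ g) [IsProbabilityMeasure μ] (t : T) (u v : Fin d₁ × Fin d₂) :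
    HasAllMoments (fun ω => gramMatrix g t ω u v) μ := by
  simp only [gramMatrix, Matrix.of_apply]
  exact HasAllMoments.sum fun _ _ => (hg.hasAllMoments _).mul (hg.hasAllMoments _).star

/-- The traces of powers of the rescaled matrix have all moments if the entries do. -/
theorem hasAllMoments_trace_rescaledSwapping_pow [IsProbabilityMeasure μ]
    {W₁ W₂ : Ω → Matrix (Fin d₁ × Fin d₂) (Fin d₁ × Fin d₂) ℂ}
    (h₁ : ∀ u v, HasAllMoments (fun ω => W₁ ω u v) μ)
    (h₂ : ∀ u v, HasAllMoments (fun ω => W₂ ω u v) μ) (p : ℕ) :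
    HasAllMoments (fun ω => (rescaledSwapping s (W₁ ω) (W₂ ω) ^ p).trace) μ := by
  have hZ : ∀ a b, HasAllMoments (fun ω => rescaledSwapping s (W₁ ω) (W₂ ω) a b) μ := by
    intro a b
    simp only [rescaledSwapping, Matrix.smul_apply, Matrix.sub_apply, entanglementSwapping_apply,
      smul_eq_mul]
    exact (HasAllMoments.const _).mul (((HasAllMoments.const _).mul ((HasAllMoments.const _).mul
      (HasAllMoments.sum fun x _ => HasAllMoments.sum fun y _ => (h₁ _ _).mul (h₂ _ _)))).sub
        (HasAllMoments.const _))
  have hpow : ∀ (p : ℕ) a b,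
      HasAllMoments (fun ω => (rescaledSwapping s (W₁ ω) (W₂ ω) ^ p) a b) μ := by
    intro p
    induction p with
    | zero =>
      intro a b
      simp only [pow_zero]
      exact HasAllMoments.const _
    | succ p ih =>
      intro a b
      simp only [pow_succ, Matrix.mul_apply]
      exact HasAllMoments.sum fun c _ => (ih a c).mul (hZ c b)
  exact HasAllMoments.sum fun a _ => hpow p a a

/-- A permutation acting on the first factor. -/
def firstFactorPerm {R : Type*} (α : Perm R) : Perm (R × Bool) :=
  Equiv.prodCongr α (Equiv.refl Bool)

theorem firstFactorPerm_apply {R : Type*} (α : Perm R) (q : R × Bool) :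
    firstFactorPerm α q = (α q.1, q.2) := rfl

/-- The number of `d₁`-dimensional index assignments compatible with a pairing. -/
noncomputable def pairingCount {R : Type*} (d : ℕ) (σ : Perm (R × Bool)) : ℕ :=
  Nat.card {x : (R → Fin d) × (R → Fin d) // ∀ q, x.1 (σ q).1 = x.2 q.1}

/-- The constraint decouples by index type: the s-indices are constant on cycles of σ, the
d₂-indices on cycles of γσ⁻¹ because a(σ q) = a(γ q), and the d₁-indices are left to `pairingCount`,
since both legs share them. -/
theorem card_compatible_labels {R : Type*} [Fintype R] (γ : Perm R) (σ : Perm (R × Bool))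
    (e : Bool → T) (he : ∀ q, e (σ q).2 = e q.2) :
    Nat.card {z : (R → Bool → Fin d₂) × (R → Fin d₁ × Fin d₁ × (Bool → Fin s)) //
      ∀ q, rowLabel e z.1 z.2 (σ q) =
        (e q.2, (((z.2 q.1).2.1, z.1 (γ q.1) q.2), (z.2 q.1).2.2 q.2))} =
      pairingCount d₁ σ * (d₂ ^ cycleCount (firstFactorPerm γ * σ⁻¹) * s ^ cycleCount σ) := by
  have h2 := card_invariant_colourings (firstFactorPerm γ * σ⁻¹) (Fin d₂)
  have h3 := card_invariant_colourings σ (Fin s)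
  rw [Nat.card_eq_fintype_card (α := Fin _), Fintype.card_fin] at h2 h3
  rw [← h2, ← h3, pairingCount, ← Nat.card_prod, ← Nat.card_prod]
  refine Nat.card_congr
    { toFun := fun z => (⟨(fun r => (z.1.2 r).1, fun r => (z.1.2 r).2.1), ?_⟩,
        ⟨fun q => z.1.1 q.1 q.2, ?_⟩, ⟨fun q => (z.1.2 q.1).2.2 q.2, ?_⟩)
      invFun := fun w => ⟨(fun r ε => w.2.1.1 (r, ε),
        fun r => (w.1.1.1 r, w.1.1.2 r, fun ε => w.2.2.1 (r, ε))), ?_⟩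
      left_inv := fun _ => rfl
      right_inv := fun _ => rfl }
  · intro q
    have := z.2 q
    simp only [rowLabel, Prod.mk.injEq] at this
    exact this.2.1.1
  · intro q
    have := z.2 (σ⁻¹ q)
    simp only [rowLabel, Prod.mk.injEq, Perm.coe_inv, Equiv.apply_symm_apply] at this
    exact this.2.1.2.symm
  · intro q
    have := z.2 q
    simp only [rowLabel, Prod.mk.injEq] at this
    exact this.2.2
  · intro q
    obtain ⟨⟨x, hx⟩, ⟨a, ha⟩, ⟨k, hk⟩⟩ := w
    have := ha (σ q)
    rw [Perm.mul_apply, Perm.coe_inv, Equiv.symm_apply_apply, firstFactorPerm_apply] at this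
    simp only [rowLabel, he, hx, hk, this]

open Classical in
/-- The moments of the rescaled matrix as a sum over pairings. -/
theorem IsGaussianFamily.integral_trace_rescaledSwapping [IsProbabilityMeasure μ] [Fintype T]
    {g : T × ((Fin d₁ × Fin d₂) × Fin s) → Ω → ℂ} (hg : IsGaussianFamily μ g)
    (hd₁ : d₁ ≠ 0) (hd₂ : d₂ ≠ 0) (hs : s ≠ 0) (e : Bool → T) (n : ℕ) :
    ∫ ω, (rescaledSwapping s (gramMatrix g (e false) ω) (gramMatrix g (e true) ω) ^ (n + 1)).trace ∂μ
      = ∑ σ : Perm (Fin (n + 1) × Bool) with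
          (∀ q, e (σ q).2 = e q.2) ∧ ∀ r, ¬ ∀ ε, σ (r, ε) = (r, ε),
        ((1 / ((d₁ : ℂ) * d₂ * s)) ^ (n + 1) * (pairingCount d₁ σ *
          (d₂ ^ cycleCount (firstFactorPerm (finRotate (n + 1)) * σ⁻¹) * s ^ cycleCount σ))) := by
  let Y := Fin d₁ × Fin d₁ × (Bool → Fin s)
  let row (z : (Fin (n + 1) → Bool → Fin d₂) × (Fin (n + 1) → Y)) := rowLabel e z.1 z.2
  let col (z : (Fin (n + 1) → Bool → Fin d₂) × (Fin (n + 1) → Y)) (q : Fin (n + 1) × Bool) :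
      T × ((Fin d₁ × Fin d₂) × Fin s) :=
    (e q.2, (((z.2 q.1).2.1, z.1 (finRotate (n + 1) q.1) q.2), (z.2 q.1).2.2 q.2))
  have hexp : ∀ ω, (rescaledSwapping s (gramMatrix g (e false) ω) (gramMatrix g (e true) ω) ^
      (n + 1)).trace = (1 / ((d₁ : ℂ) * d₂ * s)) ^ (n + 1) * ∑ z,
        ∏ r, (∏ ε, (g (row z (r, ε)) ω * conj (g (col z (r, ε)) ω)) -
          ∏ ε, if row z (r, ε) = col z (r, ε) then (1 : ℂ) else 0) := by
    intro ω
    rw [Matrix.trace_pow_succ_eq_sum,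
      ← (Equiv.arrowCongr (Equiv.refl _) (Equiv.boolArrowEquivProd (Fin d₂))).sum_comp,
      Fintype.sum_prod_type, Finset.mul_sum]
    refine Finset.sum_congr rfl fun a _ => ?_
    have : ∀ r, rescaledSwapping s (gramMatrix g (e false) ω) (gramMatrix g (e true) ω)
        (Equiv.arrowCongr (Equiv.refl _) (Equiv.boolArrowEquivProd (Fin d₂)) a r)
        (Equiv.arrowCongr (Equiv.refl _) (Equiv.boolArrowEquivProd (Fin d₂)) a
          (finRotate (n + 1) r)) = _ := fun r =>
      rescaledSwapping_gramMatrix_apply hd₁ hd₂ hs g e ω (a r) (a (finRotate (n + 1) r))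
    simp only [this]
    rw [Finset.prod_mul_distrib, Finset.prod_const, Finset.card_univ, Fintype.card_fin,
      Fintype.prod_sum]
    rfl
  have hint : ∀ z, Integrable (fun ω => ∏ r, (∏ ε, (g (row z (r, ε)) ω *
      conj (g (col z (r, ε)) ω)) - ∏ ε, if row z (r, ε) = col z (r, ε) then (1 : ℂ) else 0)) μ :=
    fun z => (HasAllMoments.prod fun r _ => (HasAllMoments.prod fun ε _ =>
      (hg.hasAllMoments _).mul (hg.hasAllMoments _).star).sub (HasAllMoments.const _)).integrable
  simp only [hexp]
  rw [integral_const_mul, integral_finsetSum _ fun z _ => hint z, ← Finset.mul_sum]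
  congr 1
  have hwick : ∀ z, ∫ ω, ∏ r, (∏ ε, (g (row z (r, ε)) ω *
      conj (g (col z (r, ε)) ω)) - ∏ ε, if row z (r, ε) = col z (r, ε) then (1 : ℂ) else 0) ∂μ =
      (Nat.card {σ : Perm (Fin (n + 1) × Bool) // (∀ q, row z (σ q) = col z q) ∧
        ∀ r, ¬ ∀ ε, σ (r, ε) = (r, ε)} : ℂ) := fun z => by
    rw [← hg.wick_centred (row z) (col z)]
    congr!
  simp only [hwick, Nat.card_eq_fintype_card, Fintype.card_subtype, Finset.card_filter,
    Nat.cast_sum]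
  rw [Finset.sum_comm, Finset.sum_filter]
  refine Finset.sum_congr rfl fun σ _ => ?_
  by_cases hok : ∀ r, ¬ ∀ ε, σ (r, ε) = (r, ε)
  · by_cases he : ∀ q, e (σ q).2 = e q.2
    · rw [if_pos ⟨he, hok⟩]
      have hc := card_compatible_labels (d₁ := d₁) (d₂ := d₂) (s := s) (finRotate (n + 1)) σ e he
      rw [Nat.card_eq_fintype_card, Fintype.card_subtype, Finset.card_filter] at hc
      have hc' := congrArg (Nat.cast : ℕ → ℂ) hc
      push_cast at hc' ⊢
      rw [← hc']
      exact Finset.sum_congr rfl fun z _ => if_congr (and_iff_left hok) rfl rfl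
    · rw [if_neg fun h => he h.1]
      refine Finset.sum_eq_zero fun z _ => ?_
      rw [if_neg fun h => he fun q => congrArg Prod.fst (h.1 q), Nat.cast_zero]
  · rw [if_neg fun h => hok h.2]
    exact Finset.sum_eq_zero fun z _ => by rw [if_neg fun h => hok h.2, Nat.cast_zero]

end Expansion

/-! ### Leading pairings and the limit of each contribution. -/

section Asymptotics

open Equiv

theorem firstFactorPerm_mul {R : Type*} (α β : Perm R) :
    firstFactorPerm (α * β) = firstFactorPerm α * firstFactorPerm β := rfl

theorem firstFactorPerm_inv {R : Type*} (α : Perm R) :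
    firstFactorPerm α⁻¹ = (firstFactorPerm α)⁻¹ := rfl

theorem cycleCount_firstFactorPerm {R : Type*} [Finite R] (α : Perm R) :
    cycleCount (firstFactorPerm α) = 2 * cycleCount α := by
  -- Two colours are used so that the counts are powers of 2, from which the exponents can be read
  -- off.
  have h1 := card_invariant_colourings (firstFactorPerm α) Bool
  have h2 := card_invariant_colourings α Bool
  have h3 : Nat.card {f : R × Bool → Bool // ∀ q, f (firstFactorPerm α q) = f q} =
      Nat.card ({f : R → Bool // ∀ r, f (α r) = f r} × {f : R → Bool // ∀ r, f (α r) = f r}) :=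
    Nat.card_congr
      { toFun := fun f => (⟨fun r => f.1 (r, false), fun r => f.2 (r, false)⟩,
          ⟨fun r => f.1 (r, true), fun r => f.2 (r, true)⟩)
        invFun := fun f => ⟨fun q => if q.2 then f.2.1 q.1 else f.1.1 q.1, fun q => by
          simp only [firstFactorPerm_apply, f.1.2, f.2.2]⟩
        left_inv := fun f => by
          ext ⟨r, _ | _⟩ <;> rfl
        right_inv := fun f => rfl }
  rw [h1, Nat.card_prod, h2, ← pow_add, ← two_mul] at h3
  exact Nat.pow_right_injective le_rfl (by simpa using h3)

theorem pairingCount_le {R : Type*} [Fintype R] (d : ℕ) (σ : Perm (R × Bool)) :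
    pairingCount d σ ≤ d ^ Fintype.card R := by
  have h : Nat.card (R → Fin d) = d ^ Fintype.card R := by simp [Nat.card_fun]
  rw [← h]
  refine Nat.card_le_card_of_injective (fun x => x.1.1) fun x y hxy => ?_
  refine Subtype.ext (Prod.ext hxy (funext fun r => ?_))
  rw [← x.2 (r, false), ← y.2 (r, false)]
  exact congrFun hxy _

theorem pairingCount_of_fst_eq {R : Type*} [Fintype R] (d : ℕ) {σ : Perm (R × Bool)}
    (h : ∀ r, (σ (r, false)).1 = (σ (r, true)).1) : pairingCount d σ = d ^ Fintype.card R := by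
  have hc : Nat.card (R → Fin d) = d ^ Fintype.card R := by simp [Nat.card_fun]
  refine le_antisymm (pairingCount_le d σ) ?_
  rw [← hc]
  refine Nat.card_le_card_of_injective (fun x => ⟨(x, fun r => x (σ (r, false)).1), ?_⟩)
    fun x y hxy => congrArg (fun z => z.1.1) hxy
  rintro ⟨r, _ | _⟩
  · rfl
  · exact congrArg x (h r).symm

/-- If the legs of r go to different factors, the values of x at both targets equal x' r. One of
them is redundant, and overwriting it with a free value is injective. -/
theorem pairingCount_mul_le {R : Type*} [Fintype R] (d : ℕ) {σ : Perm (R × Bool)}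
    (h : ¬ ∀ r, (σ (r, false)).1 = (σ (r, true)).1) :
    pairingCount d σ * d ≤ d ^ Fintype.card R := by
  classical
  push Not at h
  obtain ⟨r, hr⟩ := h
  have hc : Nat.card (R → Fin d) = d ^ Fintype.card R := by simp
  have hd : Nat.card (Fin d) = d := by simp
  have hp : Nat.card ({x : (R → Fin d) × (R → Fin d) // ∀ q, x.1 (σ q).1 = x.2 q.1} × Fin d) =
      pairingCount d σ * d := by
    rw [Nat.card_prod, hd, pairingCount]
  rw [← hc, ← hp]
  refine Nat.card_le_card_of_injective
    (fun x => Function.update x.1.1.1 (σ (r, true)).1 x.2) ?_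
  rintro ⟨⟨⟨x, x'⟩, hx⟩, u⟩ ⟨⟨⟨y, y'⟩, hy⟩, v⟩ hxy
  simp only at hxy hx hy
  have huv : u = v := by simpa using congrFun hxy (σ (r, true)).1
  have hne : ∀ w, w ≠ (σ (r, true)).1 → x w = y w := fun w hw => by
    simpa [hw] using congrFun hxy w
  have hxy' : x = y := funext fun w => by
    by_cases hw : w = (σ (r, true)).1
    · rw [hw, hx, hy, ← hx (r, false), ← hy (r, false)]
      exact hne _ hr
    · exact hne w hw
  have hxy'' : x' = y' := funext fun w => by rw [← hx (w, false), ← hy (w, false), hxy']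
  simp only [huv, hxy', hxy'']

variable {n : ℕ}

theorem cycleCount_firstFactorPerm_finRotate :
    cycleCount (firstFactorPerm (finRotate (n + 1))) = 2 := by
  rw [cycleCount_firstFactorPerm, cycleCount_finRotate]

theorem cycleCount_add_le_of_two_cycles (σ : Perm (Fin (n + 1) × Bool)) :
    cycleCount (firstFactorPerm (finRotate (n + 1)) * σ⁻¹) + cycleCount σ ≤ 2 * (n + 1) + 2 := by
  have := cycleCount_mul_inv_add_le σ (firstFactorPerm (finRotate (n + 1)))
  rw [cycleCount_firstFactorPerm_finRotate, Fintype.card_prod, Fintype.card_fin,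
    Fintype.card_bool] at this
  lia

/-- The pairings that contribute in the limit. -/
def IsLeadingPairing (σ : Perm (Fin (n + 1) × Bool)) : Prop :=
  (∀ r, (σ (r, false)).1 = (σ (r, true)).1) ∧
    cycleCount (firstFactorPerm (finRotate (n + 1)) * σ⁻¹) + cycleCount σ = 2 * (n + 1) + 2

theorem isLeadingPairing_firstFactorPerm {α : Perm (Fin (n + 1))} :
    IsLeadingPairing (firstFactorPerm α) ↔ IsGeodesic α := by
  rw [IsLeadingPairing, IsGeodesic, ← firstFactorPerm_inv, ← firstFactorPerm_mul,
    cycleCount_firstFactorPerm, cycleCount_firstFactorPerm]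
  refine ⟨fun h => by lia, fun h => ⟨fun r => rfl, by lia⟩⟩

theorem IsLeadingPairing.exists_eq {σ : Perm (Fin (n + 1) × Bool)} (h : IsLeadingPairing σ) :
    ∃ α : Perm (Fin (n + 1)), firstFactorPerm α = σ := by
  have hle := fixedFunctions_le_of_geodesic (σ := σ) (γ := firstFactorPerm (finRotate (n + 1)))
    (by
      rw [cycleCount_firstFactorPerm_finRotate, Fintype.card_prod, Fintype.card_fin,
        Fintype.card_bool]
      have := h.2
      lia)
  -- The two cycles of γ are the two legs. By the geodesic property σ preserves the indicator of a
  -- leg, so it never exchanges legs.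
  have hmem : (fun q : Fin (n + 1) × Bool => if q.2 = true then (1 : ℚ) else 0) ∈
      fixedFunctions (firstFactorPerm (finRotate (n + 1))) := fun q => rfl
  have hsnd : ∀ q, (σ q).2 = q.2 := fun q => by
    have := ite_one_zero_inj.1 (mem_fixedFunctions.1 (hle hmem) q)
    exact Bool.eq_iff_iff.2 this
  have hinj : Function.Injective fun r => (σ (r, false)).1 := fun r r' hr => by
    have : σ (r, false) = σ (r', false) := Prod.ext hr ((hsnd (r, false)).trans (hsnd (r', false)).symm)
    exact congrArg Prod.fst (σ.injective this)
  refine ⟨Equiv.ofBijective _ (Finite.injective_iff_bijective.1 hinj), ?_⟩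
  ext1 ⟨r, ε⟩
  refine Prod.ext ?_ (hsnd (r, ε)).symm
  cases ε
  · rfl
  · exact h.1 r

-- The right-hand side does not involve `e`: leading pairings preserve the leg and so satisfy every
-- label constraint. This is where Cases I and II merge.
open Classical in
theorem sum_isLeadingPairing {T M : Type*} [AddCommMonoid M] (e : Bool → T) (f : ℕ → M) :
    ∑ σ : Perm (Fin (n + 1) × Bool) with
        (∀ q, e (σ q).2 = e q.2) ∧ ∀ r, ¬ ∀ ε, σ (r, ε) = (r, ε),
      (if IsLeadingPairing σ then f (cycleCount σ) else 0) =
    ∑ α : Perm (Fin (n + 1)) with IsGeodesic α ∧ ∀ r, α r ≠ r, f (2 * cycleCount α) := by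
  rw [← Finset.sum_filter, Finset.filter_filter]
  symm
  refine Finset.sum_bij (fun α _ => firstFactorPerm α) ?_ ?_ ?_ ?_
  · intro α hα
    simp only [Finset.mem_filter, Finset.mem_univ, true_and] at hα ⊢
    refine ⟨⟨fun q => rfl, fun r hr => hα.2 r ?_⟩, isLeadingPairing_firstFactorPerm.2 hα.1⟩
    exact congrArg Prod.fst (hr true)
  · intro α _ β _ h
    ext1 r
    exact congrArg Prod.fst (DFunLike.congr_fun h (r, true))
  · intro σ hσ
    simp only [Finset.mem_filter, Finset.mem_univ, true_and] at hσ
    obtain ⟨α, rfl⟩ := hσ.2.exists_eq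
    refine ⟨α, ?_, rfl⟩
    simp only [Finset.mem_filter, Finset.mem_univ, true_and]
    refine ⟨isLeadingPairing_firstFactorPerm.1 hσ.2, fun r hr => hσ.1.2 r fun ε => ?_⟩
    exact Prod.ext hr rfl
  · intro α _
    rw [cycleCount_firstFactorPerm]

open Classical in
/-- The limit of the contribution of one pairing. -/
theorem tendsto_pairing {ι : Type*} {l : Filter ι} {c : ℝ} (hc : 0 < c) {d₁ d₂ s : ι → ℕ}
    (hd₁ : Tendsto d₁ l atTop) (hd₂ : Tendsto d₂ l atTop)
    (hs : Tendsto (fun i => (s i : ℝ) / (d₂ i : ℝ)) l (𝓝 c)) (σ : Perm (Fin (n + 1) × Bool)) :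
    Tendsto (fun i => 1 / (d₂ i : ℝ) ^ 2 * ((1 / ((d₁ i : ℝ) * d₂ i * s i)) ^ (n + 1) *
      (pairingCount (d₁ i) σ * (d₂ i ^ cycleCount (firstFactorPerm (finRotate (n + 1)) * σ⁻¹) *
        s i ^ cycleCount σ)))) l
      (𝓝 (if IsLeadingPairing σ then c ^ ((cycleCount σ : ℤ) - ((n + 1 : ℕ) : ℤ)) else 0)) := by
  set c₂ := cycleCount (firstFactorPerm (finRotate (n + 1)) * σ⁻¹) with hc₂
  set c₃ := cycleCount σ with hc₃
  have h1 : ∀ᶠ i in l, (d₁ i : ℝ) ≠ 0 :=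
    (hd₁.eventually_ge_atTop 1).mono fun i hi => by positivity
  have h2 : ∀ᶠ i in l, (d₂ i : ℝ) ≠ 0 :=
    (hd₂.eventually_ge_atTop 1).mono fun i hi => by positivity
  have h3 : ∀ᶠ i in l, (s i : ℝ) ≠ 0 := by
    filter_upwards [hs.eventually_ne hc.ne'] with i hi h0
    simp [h0] at hi
  have hd₁' : Tendsto (fun i => (d₁ i : ℝ)) l atTop := tendsto_natCast_atTop_atTop.comp hd₁
  have hd₂' : Tendsto (fun i => (d₂ i : ℝ)) l atTop := tendsto_natCast_atTop_atTop.comp hd₂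
  -- Trading s for (s/d₂)·d₂ rewrites the term as (N(σ)/d₁^(n+1)) · d₂^(c₂+c₃−2(n+1)−2) ·
  -- (s/d₂)^(c₃−(n+1)), whose last factor converges.
  have hfactor : Tendsto (fun i => ((s i : ℝ) / d₂ i) ^ ((c₃ : ℤ) - ((n + 1 : ℕ) : ℤ))) l
      (𝓝 (c ^ ((c₃ : ℤ) - ((n + 1 : ℕ) : ℤ)))) := hs.zpow₀ _ (Or.inl hc.ne')
  have hle : c₂ + c₃ ≤ 2 * (n + 1) + 2 := cycleCount_add_le_of_two_cycles σ
  have hA : Tendsto (fun i => (pairingCount (d₁ i) σ : ℝ) / (d₁ i : ℝ) ^ (n + 1) *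
      ((d₂ i : ℝ) ^ (c₂ + c₃) / (d₂ i : ℝ) ^ (2 * (n + 1) + 2))) l
      (𝓝 (if IsLeadingPairing σ then 1 else 0)) := by
    have hcount : ∀ i, (pairingCount (d₁ i) σ : ℝ) / (d₁ i : ℝ) ^ (n + 1) ≤ 1 := fun i => by
      refine div_le_one_of_le₀ ?_ (by positivity)
      have := pairingCount_le (d₁ i) σ
      rw [Fintype.card_fin] at this
      exact_mod_cast this
    have hcount0 : ∀ i, 0 ≤ (pairingCount (d₁ i) σ : ℝ) / (d₁ i : ℝ) ^ (n + 1) := fun i => by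
      positivity
    by_cases hfst : ∀ r, (σ (r, false)).1 = (σ (r, true)).1
    · by_cases heq : c₂ + c₃ = 2 * (n + 1) + 2
      · rw [if_pos ⟨hfst, heq⟩]
        refine Tendsto.congr' ?_ tendsto_const_nhds
        filter_upwards [h1, h2] with i hi1 hi2
        rw [heq, div_self (pow_ne_zero _ hi2), pairingCount_of_fst_eq _ hfst, Fintype.card_fin,
          Nat.cast_pow, div_self (pow_ne_zero _ hi1), one_mul]
      · rw [if_neg fun h => heq h.2]
        refine squeeze_zero (fun i => mul_nonneg (hcount0 i) (by positivity))
          (fun i => mul_le_of_le_one_left (by positivity) (hcount i)) ?_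
        exact (tendsto_pow_div_pow_atTop_zero (lt_of_le_of_ne hle heq)).comp hd₂'
    -- Here the d₂-part is only bounded by 1, and the decay comes from N(σ)/d₁^(n+1) ≤ 1/d₁.
    · rw [if_neg fun h => hfst h.1]
      refine squeeze_zero' (Eventually.of_forall fun i => mul_nonneg (hcount0 i) (by positivity))
        ?_ (tendsto_inv_atTop_zero.comp hd₁')
      filter_upwards [h1, hd₂.eventually_ge_atTop 1] with i hi1 hi2
      have hi2' : (1 : ℝ) ≤ d₂ i := by exact_mod_cast hi2
      refine (mul_le_of_le_one_right (hcount0 i) (div_le_one_of_le₀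
        (pow_le_pow_right₀ hi2' hle) (by positivity))).trans ?_
      have hpos : (0 : ℝ) < d₁ i := lt_of_le_of_ne (Nat.cast_nonneg _) hi1.symm
      rw [Function.comp_apply, div_le_iff₀ (pow_pos hpos _), inv_mul_eq_div, le_div_iff₀ hpos]
      have := pairingCount_mul_le (d₁ i) hfst
      rw [Fintype.card_fin] at this
      exact_mod_cast this
  have hprod := hA.mul hfactor
  rw [ite_mul, one_mul, zero_mul] at hprod
  refine hprod.congr' ?_
  filter_upwards [h1, h2, h3] with i hi1 hi2 hi3
  rw [zpow_sub₀ (div_ne_zero hi3 hi2), zpow_natCast, zpow_natCast]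
  simp only [div_pow, mul_pow, one_pow, pow_add _ c₂, pow_add _ (2 * (n + 1)), pow_mul' _ 2]
  field_simp

end Asymptotics

/-! ### Reduction of both cases to one pair of independent Gaussian matrices. -/

section Model

open scoped ComplexConjugate

/-- The entries of a pair of random matrices as one family. -/
def pairEntries {m k : Type*} (t : Bool × (m × k)) (ω : (m → k → ℂ) × (m → k → ℂ)) : ℂ :=
  if t.1 then ω.2 t.2.1 t.2.2 else ω.1 t.2.1 t.2.2

theorem isGaussianFamily_pairEntries (m k : Type*) [Fintype m] [Fintype k] :
    IsGaussianFamily ((gaussianMatrix m k).prod (gaussianMatrix m k))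
      (pairEntries (m := m) (k := k)) :=
  (isGaussianFamily_gaussianMatrix m k).prod (isGaussianFamily_gaussianMatrix m k)

variable {d₁ d₂ s : ℕ}

theorem measurable_mul_conjTranspose {m k : Type*} [Fintype k] :
    Measurable fun x : m → k → ℂ => Matrix.of x * (Matrix.of x)ᴴ := by
  refine measurable_pi_lambda _ fun u => measurable_pi_lambda _ fun v => ?_
  simp only [Matrix.mul_apply, Matrix.of_apply, Matrix.conjTranspose_apply]
  have hentry : ∀ u j, Measurable fun x : m → k → ℂ => x u j := fun u j =>
    (measurable_pi_apply j).comp (measurable_pi_apply u)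
  exact Finset.measurable_sum _ fun j _ =>
    (hentry u j).mul (Complex.continuous_conj.measurable.comp (hentry v j))

theorem measurable_trace_rescaledSwapping_pow (s p : ℕ) :
    Measurable fun w : Matrix (Fin d₁ × Fin d₂) (Fin d₁ × Fin d₂) ℂ ×
      Matrix (Fin d₁ × Fin d₂) (Fin d₁ × Fin d₂) ℂ => (rescaledSwapping s w.1 w.2 ^ p).trace := by
  have hentry : ∀ u v, Measurable fun w : Matrix (Fin d₁ × Fin d₂) (Fin d₁ × Fin d₂) ℂ => w u v :=
    fun u v => (measurable_pi_apply v).comp (measurable_pi_apply u)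
  have hZ : ∀ a b, Measurable fun w : Matrix (Fin d₁ × Fin d₂) (Fin d₁ × Fin d₂) ℂ ×
      Matrix (Fin d₁ × Fin d₂) (Fin d₁ × Fin d₂) ℂ => rescaledSwapping s w.1 w.2 a b := by
    intro a b
    simp only [rescaledSwapping, Matrix.smul_apply, Matrix.sub_apply, entanglementSwapping_apply,
      smul_eq_mul]
    exact (((Finset.measurable_sum _ fun x _ => Finset.measurable_sum _ fun y _ =>
      ((hentry _ _).comp measurable_fst).mul ((hentry _ _).comp measurable_snd)).const_mul
        _).const_mul _ |>.sub_const _).const_mul _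
  have hpow : ∀ (p : ℕ) a b, Measurable fun w : Matrix (Fin d₁ × Fin d₂) (Fin d₁ × Fin d₂) ℂ ×
      Matrix (Fin d₁ × Fin d₂) (Fin d₁ × Fin d₂) ℂ => (rescaledSwapping s w.1 w.2 ^ p) a b := by
    intro p
    induction p with
    | zero =>
      intro a b
      simp only [pow_zero]
      exact measurable_const
    | succ p ih =>
      intro a b
      simp only [pow_succ, Matrix.mul_apply]
      exact Finset.measurable_sum _ fun c _ => (ih a c).mul (hZ c b)
  exact Finset.measurable_sum _ fun a _ => hpow p a a

theorem gramMatrix_pairEntries (ε : Bool)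
    (ω : (Fin d₁ × Fin d₂ → Fin s → ℂ) × (Fin d₁ × Fin d₂ → Fin s → ℂ)) :
    gramMatrix pairEntries ε ω =
      Matrix.of (if ε then ω.2 else ω.1) * (Matrix.of (if ε then ω.2 else ω.1))ᴴ := by
  ext u v
  cases ε <;> rfl

theorem measurable_gramMatrix_pairEntries (ε : Bool) :
    Measurable (gramMatrix (d₁ := d₁) (d₂ := d₂) (s := s) pairEntries ε) := by
  rw [show gramMatrix (d₁ := d₁) (d₂ := d₂) (s := s) pairEntries ε = _ from
    funext (gramMatrix_pairEntries ε)]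
  cases ε
  · exact measurable_mul_conjTranspose.comp measurable_fst
  · exact measurable_mul_conjTranspose.comp measurable_snd

/-- The joint law of two Wishart matrices that are independent or equal. -/
theorem map_pair_eq_map_gramMatrix {Ω : Type*} [MeasurableSpace Ω] {P : Measure Ω}
    [IsProbabilityMeasure P] {W₁ W₂ : Ω → Matrix (Fin d₁ × Fin d₂) (Fin d₁ × Fin d₂) ℂ}
    (hW₁ : HasLaw W₁ (wishart (Fin d₁ × Fin d₂) s) P)
    (hW₂ : HasLaw W₂ (wishart (Fin d₁ × Fin d₂) s) P) (e : Bool → Bool)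
    (h : (e = id ∧ IndepFun W₁ W₂ P) ∨ (e = (fun _ => true) ∧ W₁ = W₂)) :
    P.map (fun ω => (W₁ ω, W₂ ω)) =
      ((gaussianMatrix (Fin d₁ × Fin d₂) (Fin s)).prod
        (gaussianMatrix (Fin d₁ × Fin d₂) (Fin s))).map
        fun ω => (gramMatrix pairEntries (e false) ω, gramMatrix pairEntries (e true) ω) := by
  rcases h with ⟨rfl, hind⟩ | ⟨rfl, rfl⟩
  · rw [(indepFun_iff_map_prod_eq_prod_map_map hW₁.aemeasurable hW₂.aemeasurable).1 hind,
      hW₁.map_eq, hW₂.map_eq, wishart, Measure.map_prod_map _ _ measurable_mul_conjTranspose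
        measurable_mul_conjTranspose]
    congr 1
  -- Equal matrices are modelled by using the second Gaussian matrix for both legs; the first is
  -- integrated out.
  · have hdiag : Measurable fun w : Matrix (Fin d₁ × Fin d₂) (Fin d₁ × Fin d₂) ℂ => (w, w) :=
      measurable_id.prodMk measurable_id
    have hfst : gaussianMatrix (Fin d₁ × Fin d₂) (Fin s) =
        ((gaussianMatrix (Fin d₁ × Fin d₂) (Fin s)).prod
          (gaussianMatrix (Fin d₁ × Fin d₂) (Fin s))).map Prod.snd :=
      measurePreserving_snd.map_eq.symm
    have h1 : P.map (fun ω => (W₁ ω, W₁ ω)) = (P.map W₁).map fun w => (w, w) :=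
      (AEMeasurable.map_map_of_aemeasurable hdiag.aemeasurable hW₁.aemeasurable).symm
    rw [h1, hW₁.map_eq, wishart, hfst, Measure.map_map measurable_mul_conjTranspose measurable_snd,
      Measure.map_map hdiag (measurable_mul_conjTranspose.comp measurable_snd), ← hfst]
    rfl

theorem integrable_and_integral_trace_rescaledSwapping {Ω : Type*} [MeasurableSpace Ω]
    {P : Measure Ω} [IsProbabilityMeasure P]
    {W₁ W₂ : Ω → Matrix (Fin d₁ × Fin d₂) (Fin d₁ × Fin d₂) ℂ}
    (hW₁ : HasLaw W₁ (wishart (Fin d₁ × Fin d₂) s) P)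
    (hW₂ : HasLaw W₂ (wishart (Fin d₁ × Fin d₂) s) P) (e : Bool → Bool)
    (h : (e = id ∧ IndepFun W₁ W₂ P) ∨ (e = (fun _ => true) ∧ W₁ = W₂)) (p : ℕ) :
    Integrable (fun ω => (rescaledSwapping s (W₁ ω) (W₂ ω) ^ p).trace) P ∧
    ∫ ω, (rescaledSwapping s (W₁ ω) (W₂ ω) ^ p).trace ∂P =
      ∫ ω, (rescaledSwapping s (gramMatrix pairEntries (e false) ω)
        (gramMatrix pairEntries (e true) ω) ^ p).trace
        ∂((gaussianMatrix (Fin d₁ × Fin d₂) (Fin s)).prod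
          (gaussianMatrix (Fin d₁ × Fin d₂) (Fin s))) := by
  have hmap := map_pair_eq_map_gramMatrix hW₁ hW₂ e h
  have hpair : AEMeasurable (fun ω => (W₁ ω, W₂ ω)) P := hW₁.aemeasurable.prodMk hW₂.aemeasurable
  have hgram := (measurable_gramMatrix_pairEntries (d₁ := d₁) (d₂ := d₂) (s := s)
    (e false)).prodMk (measurable_gramMatrix_pairEntries (e true))
  have hmeas := (measurable_trace_rescaledSwapping_pow (d₁ := d₁) (d₂ := d₂) s p)
  have hfam := isGaussianFamily_pairEntries (Fin d₁ × Fin d₂) (Fin s)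
  constructor
  · have h := (hasAllMoments_trace_rescaledSwapping_pow (s := s)
      (hfam.hasAllMoments_gramMatrix (e false))
      (hfam.hasAllMoments_gramMatrix (e true)) p).integrable
    refine (integrable_map_measure hmeas.aestronglyMeasurable hpair).1 ?_
    rw [hmap]
    exact (integrable_map_measure hmeas.aestronglyMeasurable hgram.aemeasurable).2 h
  · have h1 := integral_map hpair hmeas.aestronglyMeasurable
    have h2 := integral_map hgram.aemeasurable
      (hmeas.aestronglyMeasurable (μ := ((gaussianMatrix (Fin d₁ × Fin d₂) (Fin s)).prod
          (gaussianMatrix (Fin d₁ × Fin d₂) (Fin s))).map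
            fun ω => (gramMatrix pairEntries (e false) ω, gramMatrix pairEntries (e true) ω)))
    rw [← h1, ← h2, hmap]

end Model

/-! ### The theorem. -/

theorem sum_nonCrossingNoSingletons_zero {M : Type*} [AddCommMonoid M] (f : ℕ → M) :
    ∑ π ∈ nonCrossingNoSingletons 0, f π.parts.card = f 0 := by
  have hparts : ∀ π : Finpartition (Finset.univ : Finset (Fin 0)), π.parts = ∅ := fun π =>
    Finpartition.parts_eq_empty_iff.2 rfl
  have huniv : nonCrossingNoSingletons 0 = {⊥} := by
    ext π
    have : π = ⊥ := Finpartition.ext ((hparts π).trans (hparts ⊥).symm)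
    simp [nonCrossingNoSingletons, this, IsNonCrossing]
  rw [huniv, Finset.sum_singleton, hparts, Finset.card_empty]

theorem mainTheorem1 {ι : Type*} (l : Filter ι) (c : ℝ) (hc : 0 < c)
    (d₁ d₂ s : ι → ℕ) (hd₁ : Tendsto d₁ l atTop) (hd₂ : Tendsto d₂ l atTop)
    (hs : Tendsto (fun i => (s i : ℝ) / (d₂ i : ℝ)) l (𝓝 c))
    {Ω : ι → Type*} [∀ i, MeasurableSpace (Ω i)]
    (P : ∀ i, Measure (Ω i)) [∀ i, IsProbabilityMeasure (P i)]
    (W₁ W₂ : ∀ i, Ω i → Matrix (Fin (d₁ i) × Fin (d₂ i)) (Fin (d₁ i) × Fin (d₂ i)) ℂ)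
    (hW₁ : ∀ i, HasLaw (W₁ i) (wishart (Fin (d₁ i) × Fin (d₂ i)) (s i)) (P i))
    (hW₂ : ∀ i, HasLaw (W₂ i) (wishart (Fin (d₁ i) × Fin (d₂ i)) (s i)) (P i))
    (hcase : (∀ i, IndepFun (W₁ i) (W₂ i) (P i)) ∨ (∀ i, W₁ i = W₂ i))
    (p : ℕ) :
    (∀ i, Integrable
      (fun ω => (rescaledSwapping (s i) (W₁ i ω) (W₂ i ω) ^ p).trace) (P i)) ∧
    Tendsto
      (fun i => (1 / (d₂ i : ℂ) ^ 2) *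
        ∫ ω, (rescaledSwapping (s i) (W₁ i ω) (W₂ i ω) ^ p).trace ∂(P i))
      l
      (𝓝 ((∑ π ∈ nonCrossingNoSingletons p,
        c ^ (2 * (π.parts.card : ℤ) - (p : ℤ)) : ℝ) : ℂ)) := by
  classical
  obtain ⟨e, he⟩ : ∃ e : Bool → Bool, ∀ i, (e = id ∧ IndepFun (W₁ i) (W₂ i) (P i)) ∨
      (e = (fun _ => true) ∧ W₁ i = W₂ i) := by
    rcases hcase with h | h
    · exact ⟨id, fun i => Or.inl ⟨rfl, h i⟩⟩
    · exact ⟨fun _ => true, fun i => Or.inr ⟨rfl, h i⟩⟩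
  have hmodel := fun i =>
    integrable_and_integral_trace_rescaledSwapping (hW₁ i) (hW₂ i) e (he i) p
  refine ⟨fun i => (hmodel i).1, ?_⟩
  have hfam := fun i => isGaussianFamily_pairEntries (Fin (d₁ i) × Fin (d₂ i)) (Fin (s i))
  simp only [fun i => (hmodel i).2]
  have h1 : ∀ᶠ i in l, d₁ i ≠ 0 := (hd₁.eventually_ge_atTop 1).mono fun i hi => by lia
  have h2 : ∀ᶠ i in l, d₂ i ≠ 0 := (hd₂.eventually_ge_atTop 1).mono fun i hi => by lia
  have h3 : ∀ᶠ i in l, s i ≠ 0 := by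
    filter_upwards [hs.eventually_ne hc.ne'] with i hi h0
    simp [h0] at hi
  -- The cyclic expansion needs at least one factor, so p = 0 is separate: there the trace is d₂²
  -- and the empty partition gives 1.
  rcases p with _ | n
  · rw [sum_nonCrossingNoSingletons_zero fun k => c ^ (2 * (k : ℤ) - ((0 : ℕ) : ℤ))]
    refine Tendsto.congr' ?_ tendsto_const_nhds
    filter_upwards [h2] with i hi
    have : (d₂ i : ℂ) ≠ 0 := by exact_mod_cast hi
    simp only [pow_zero, Matrix.trace_one, Fintype.card_prod, Fintype.card_fin, integral_const,
      probReal_univ, one_smul]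
    push_cast
    simp only [zpow_zero]
    field_simp
  · rw [← sum_isGeodesic_eq_sum_nonCrossing fun k => c ^ (2 * (k : ℤ) - ((n + 1 : ℕ) : ℤ))]
    have hlead := sum_isLeadingPairing (n := n) e fun k => c ^ ((k : ℤ) - ((n + 1 : ℕ) : ℤ))
    simp only [Nat.cast_mul, Nat.cast_ofNat] at hlead
    rw [← hlead]
    refine ((Complex.continuous_ofReal.tendsto _).comp (tendsto_finsetSum _ fun σ _ =>
      tendsto_pairing hc hd₁ hd₂ hs σ)).congr' ?_
    filter_upwards [h1, h2, h3] with i hi1 hi2 hi3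
    rw [(hfam i).integral_trace_rescaledSwapping hi1 hi2 hi3 e n, Function.comp_apply,
      Finset.mul_sum]
    push_cast
    rfl
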